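/- Conventions. A dynamical system $(X,G)$ is a compact metrizable space $X$ with a continuous action of a topological group $G$ by homeomorphisms; a homeomorphism $T$ of $X$ gives an action of $\mathbb{Z}$. A factor map is a continuous equivariant surjection between dynamical systems with the same group $G$. $(X,G)$ is \emph{prime} if every factor map from $X$ onto a system with more than one point is one-to-one. An \emph{affine dynamical system} $(Q,G)$ is a compact convex metrizable subset $Q$ of a real locally convex Hausdorff topological vector space on which $G$ acts by affine homeomorphisms. Let $M(X)$ be the space of Borel probability measures on $X$ with the weak$^*$ topology and the push-forward action of $G$. $(X,G)$ is \emph{affinely prime} if every affine factor map from $M(X)$ onto an affine dynamical system with more than one point is one-to-one. $(X,G)$ is \emph{strongly proximal} if for every $\mu\in M(X)$ there are a sequence $g_n\in G$ and a point $x\in X$ with $g_n\mu\to\delta_x$. $(X,G)$ has the \emph{linear Stone--Weierstrass property} (LSW) if for every non-constant $f\in C(X)=C(X,\mathbb{R})$ the uniformly closed linear span of $\{x\mapsto f(gx): g\in G\}\cup\{\mathbf 1\}$ is all of $C(X)$. Theorem. \begin{enumerate} \item For every prime number $p$, the system $(\mathbb{Z}/p\mathbb{Z},T)$ with $Tx=x+1$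 is prime, and it is affinely prime if and only if $p\in\{2,3\}$. \item If $X$ is the Cantor set and $G=\mathrm{Homeo}(X)$ is the group of all homeomorphisms of $X$ onto itself, then $(X,G)$ has LSW and is affinely prime. \item If $X=S^2$ is the unit sphere in $\mathbb{R}^3$ and $G=\mathrm{Homeo}(X)$, then $(X,G)$ has LSW and is affinely prime. \item If $X=S^2$ and $H<\mathrm{Homeo}(X)$ is the subgroup of the homeomorphisms that fix the north pole, then $(X,H)$ is affinely prime and strongly proximal, and the north pole is its unique fixed point. \item If $X=\mathbb{Z}\cup\{\infty\}$ is the one-point compactification of $\mathbb{Z}$ and $T$ is the homeomorphism with $Tx=x+1$ on $\mathbb{Z}$ and $T\infty=\infty$, then $(X,T)$ is prime and strongly proximal but does not have LSW. \end{enumerate} -/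

import Mathlib

open MeasureTheory Filter Topology



/-! Throughout, an action of a group `G` on a space `X` is a homomorphism `ψ : G →* (X ≃ₜ X)` into
the group of self-homeomorphisms of `X` (with composition as multiplication). -/

/-- `π` is a factor map from the system `(X, G, ψ)` to the system `(Y, G, φ)`: a continuous
equivariant surjection. -/
structure IsFactorMap {G : Type*} [Group G] {X : Type*} [TopologicalSpace X]
    {Y : Type*} [TopologicalSpace Y] (ψ : G →* (X ≃ₜ X)) (φ : G →* (Y ≃ₜ Y)) (π : X → Y) :
    Prop where
  continuous : Continuous π
  surjective : Function.Surjective π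
  equivariant : ∀ g x, π (ψ g x) = φ g (π x)

/-- The system `(X, G, ψ)` is prime: every factor map onto a system on a compact metrizable space
with more than one point is one-to-one. -/
def IsPrimeSystem.{z, x, y} {G : Type x} [Group G] {X : Type y} [TopologicalSpace X]
    (ψ : G →* (X ≃ₜ X)) : Prop :=
  ∀ (Y : Type z) [TopologicalSpace Y] [CompactSpace Y] [TopologicalSpace.MetrizableSpace Y]
    (φ : G →* (Y ≃ₜ Y)) (π : X → Y),
    IsFactorMap ψ φ π → Nontrivial Y → Function.Injective π

/-- The action of a homeomorphism `h` of `X` on Borel probability measures by push-forward. -/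
noncomputable def pushProba {X : Type*} [TopologicalSpace X] [MeasurableSpace X] [BorelSpace X]
    (h : X ≃ₜ X) (μ : ProbabilityMeasure X) : ProbabilityMeasure X :=
  μ.map h.continuous.measurable.aemeasurable

/-- The system `(X, G, ψ)` is strongly proximal: for every Borel probability measure `μ` there are
a sequence `g n` in `G` and a point `x` with `g n • μ → δ_x` in the weak topology. -/
def IsStronglyProximal {G : Type*} [Group G] {X : Type*} [TopologicalSpace X] [MeasurableSpace X]
    [BorelSpace X] (ψ : G →* (X ≃ₜ X)) : Prop :=
  ∀ μ : ProbabilityMeasure X, ∃ (g : ℕ → G) (x : X),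
    Tendsto (fun n => pushProba (ψ (g n)) μ) atTop (𝓝 (diracProba x))

/-- The linear Stone–Weierstrass property of a system on a compact space `X`: for every
non-constant `f ∈ C(X)`, the closed linear span of `1` and the translates `x ↦ f (g x)`, `g ∈ G`,
is all of `C(X)`. (For compact `X`, the topology of `C(X, ℝ)` is that of uniform convergence.) -/
def HasLSW {G : Type*} [Group G] {X : Type*} [TopologicalSpace X]
    (ψ : G →* (X ≃ₜ X)) : Prop :=
  ∀ f : C(X, ℝ), (¬ ∃ c : ℝ, ∀ x, f x = c) →
    (Submodule.span ℝ
      (Set.range (fun g : G => f.comp (ψ g : C(X, X))) ∪ {(1 : C(X, ℝ))})).topologicalClosure = ⊤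

/-- An affine dynamical system of the group `G` inside the real topological vector space `E`:
a compact convex metrizable subset `carrier` of `E` with an action of `G` by affine
homeomorphisms. -/
structure AffineSystem (G : Type*) [Group G] (E : Type*) [AddCommGroup E] [Module ℝ E]
    [TopologicalSpace E] where
  carrier : Set E
  isCompact : IsCompact carrier
  convex : Convex ℝ carrier
  metrizable : TopologicalSpace.MetrizableSpace carrier
  act : G →* (carrier ≃ₜ carrier)
  affine : ∀ (g : G) (p q r : carrier) (a b : ℝ), 0 ≤ a → 0 ≤ b → a + b = 1 →
    (r : E) = a • (p : E) + b • (q : E) →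
    (act g r : E) = a • (act g p : E) + b • (act g q : E)

/-- `π` is an affine factor map from the affine system `M(X)` of Borel probability measures on `X`,
with the weak topology and the push-forward action, to the affine system `S`: a continuous affine
equivariant surjection. -/
structure IsAffineFactorMap {G : Type*} [Group G] {X : Type*} [TopologicalSpace X]
    [MeasurableSpace X] [BorelSpace X] {E : Type*} [AddCommGroup E] [Module ℝ E]
    [TopologicalSpace E] (ψ : G →* (X ≃ₜ X)) (S : AffineSystem G E)
    (π : ProbabilityMeasure X → S.carrier) : Prop where
  continuous : Continuous π
  surjective : Function.Surjective π
  equivariant : ∀ g μ, π (pushProba (ψ g) μ) = S.act g (π μ)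
  affine : ∀ (μ ν ρ : ProbabilityMeasure X) (a b : NNReal), a + b = 1 →
    (ρ : Measure X) = a • (μ : Measure X) + b • (ν : Measure X) →
    (π ρ : E) = (a : ℝ) • (π μ : E) + (b : ℝ) • (π ν : E)

/-- The system `(X, G, ψ)` is affinely prime: every affine factor map from `M(X)` onto an affine
system with more than one point, in a real locally convex Hausdorff topological vector space,
is one-to-one. -/
def IsAffinelyPrime.{z, x, y} {G : Type x} [Group G] {X : Type y} [TopologicalSpace X]
    [MeasurableSpace X] [BorelSpace X] (ψ : G →* (X ≃ₜ X)) : Prop :=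
  ∀ (E : Type z) [AddCommGroup E] [Module ℝ E] [TopologicalSpace E] [IsTopologicalAddGroup E]
    [ContinuousSMul ℝ E] [LocallyConvexSpace ℝ E] [T2Space E] (S : AffineSystem G E)
    (π : ProbabilityMeasure X → S.carrier),
    IsAffineFactorMap ψ S π → S.carrier.Nontrivial → Function.Injective π

/-- The tautological action of the group `Homeo(X)` on `X`. -/
def homeoAction (X : Type*) [TopologicalSpace X] : (X ≃ₜ X) →* (X ≃ₜ X) := MonoidHom.id _

/-- The subgroup of `Homeo(X)` of the homeomorphisms that fix the point `p`. -/
def pointStabilizer {X : Type*} [TopologicalSpace X] (p : X) : Subgroup (X ≃ₜ X) where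
  carrier := {h | h p = p}
  one_mem' := rfl
  mul_mem' {f g} hf hg := by
    simp only [Set.mem_ofPred_eq, Homeomorph.mul_apply] at hf hg ⊢
    rw [hg, hf]
  inv_mem' {f} hf := by
    simp only [Set.mem_ofPred_eq, Homeomorph.inv_apply] at hf ⊢
    rw [Homeomorph.symm_apply_eq, hf]

/-- The action of `ℤ` generated by a homeomorphism `T`: the integer `n` acts as `T ^ n`. -/
def cascade {X : Type*} [TopologicalSpace X] (T : X ≃ₜ X) : Multiplicative ℤ →* (X ≃ₜ X) :=
  zpowersHom (X ≃ₜ X) T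

/-- The unit sphere `S²` in `ℝ³`. -/
abbrev Sphere2 : Type := Metric.sphere (0 : EuclideanSpace ℝ (Fin 3)) 1

/-- The north pole `(0, 0, 1)` of `S²`. -/
noncomputable def northPole : Sphere2 := ⟨EuclideanSpace.single 2 1, by simp⟩

instance (n : ℕ) : BorelSpace (ZMod n) where
  measurable_eq := by
    rw [borel_eq_top_of_discrete]; rfl

instance : MeasurableSpace (OnePoint ℤ) := borel _

instance : BorelSpace (OnePoint ℤ) := ⟨rfl⟩

/-- The map `x ↦ x + 1` on the integers modulo `p`. -/
def zmodShift (p : ℕ) : ZMod p ≃ₜ ZMod p := Homeomorph.addRight 1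

/-- The map of the one-point compactification of `ℤ` that is `x ↦ x + 1` on `ℤ` and fixes the
point at infinity. -/
def onePointShift : OnePoint ℤ ≃ₜ OnePoint ℤ := (Homeomorph.addRight (1 : ℤ)).onePointCongr

universe z

/-! A continuous affine function on M(X) is integration against its values on Dirac measures. Hence
an affine factor map π of M(X), composed with a continuous linear functional l, is determined by
f(x) = l(π(δ_x)), and l separating two points of the image makes f non-constant. If π μ = π ν, then
μ and ν agree on 1 and on every translate of f; under LSW they agree on all of C(X). So LSW implies
affine primality (`HasLSW.isAffinelyPrime`), and parts 2, 3 and 4 reduce to LSW.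

LSW says that a closed invariant subspace W containing 1 and a non-constant function is everything.
In both geometric cases, enough homeomorphisms exist to build inside W a multiplicatively closed
family that separates points; its span is an algebra and Stone–Weierstrass applies. On the sphere,
regarded as the plane plus a point at infinity (the north pole), the family consists of Gaussians,
obtained as limits of averages of f along radial homeomorphisms; only homeomorphisms fixing infinity
are used, so the stabilizer of the pole has LSW too. On the Cantor set the family consists of
indicators of clopen sets, reached because all non-empty clopen sets are homeomorphic.

For Z/p with p = 2, 3, LSW is linear algebra. For p ≥ 5, sending a measure to the barycentre in ℂ of
the corresponding p-th roots of unity is a non-injective affine factor map.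

For the translation on Z ∪ {∞}, LSW fails because of two continuous functions on the circle with
product zero and absolutely summable Fourier coefficients: a tent and its half-turn translate. The
coefficients of the tent give f, those of the translate give a signed measure on Z, and the
vanishing product says that this measure annihilates all translates of f. It also annihilates 1, yet
is not zero. -/

/-! ### Affine functions on M(X), and LSW implies affine primality -/

/-- A family of probability measures given by simple maps close to the identity converges to the
original measure. -/
theorem exists_simpleFunc_tendsto_map {X : Type*} [TopologicalSpace X] [CompactSpace X]
    [TopologicalSpace.MetrizableSpace X] [MeasurableSpace X] [BorelSpace X]
    (μ : ProbabilityMeasure X) :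
    ∃ s : ℕ → SimpleFunc X X,
      Tendsto (fun n => μ.map (s n).measurable.aemeasurable) atTop (𝓝 μ) := by
  let _ := TopologicalSpace.metrizableSpaceMetric X
  have : Nonempty X := μ.nonempty
  refine ⟨fun n => SimpleFunc.nearestPt (TopologicalSpace.denseSeq X) n, ?_⟩
  rw [ProbabilityMeasure.tendsto_iff_forall_integral_tendsto]
  intro f
  have h : ∀ n, ∫ x, f x ∂((μ.map (SimpleFunc.nearestPt
      (TopologicalSpace.denseSeq X) n).measurable.aemeasurable : ProbabilityMeasure X) : Measure X)
      = ∫ x, f (SimpleFunc.nearestPt (TopologicalSpace.denseSeq X) n x) ∂(μ : Measure X) := by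
    intro n
    rw [ProbabilityMeasure.toMeasure_map, integral_map]
    · exact (SimpleFunc.measurable _).aemeasurable
    · exact f.continuous.aestronglyMeasurable
  simp only [h]
  refine tendsto_integral_of_dominated_convergence (fun _ => ‖f‖) ?_ ?_ ?_ ?_
  · intro n
    exact (f.continuous.measurable.comp (SimpleFunc.measurable _)).aestronglyMeasurable
  · exact integrable_const _
  · intro n
    exact ae_of_all _ fun x => f.norm_coe_le_norm _
  · refine ae_of_all _ fun x => (f.continuous.tendsto x).comp ?_
    exact SimpleFunc.tendsto_nearestPt (TopologicalSpace.denseRange_denseSeq X x)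

/-- A real function on probability measures that is affine is given by integration on finitely
supported measures. -/
theorem affine_eq_integral_of_finite_support {X : Type*} [TopologicalSpace X] [T1Space X]
    [MeasurableSpace X] [BorelSpace X] (A : ProbabilityMeasure X → ℝ)
    (hA : ∀ (μ ν ρ : ProbabilityMeasure X) (a b : NNReal), a + b = 1 →
      (ρ : Measure X) = a • (μ : Measure X) + b • (ν : Measure X) →
      A ρ = (a : ℝ) * A μ + (b : ℝ) * A ν)
    (f : X → ℝ) (hf : ∀ x, f x = A (diracProba x)) (hfm : Measurable f) (s : Finset X) :
    ∀ ρ : ProbabilityMeasure X, (ρ : Measure X) (s : Set X)ᶜ = 0 →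
      A ρ = ∫ x, f x ∂(ρ : Measure X) := by
  classical
  induction s using Finset.induction_on with
  | empty => intro ρ h; simp at h
  | insert x s hx ih =>
    intro ρ hρ
    have hd : A (diracProba x) = ∫ y, f y ∂(diracProba x : Measure X) := by
      rw [← hf]; simp [diracProba]
    -- The atom at `x` is split off and the remainder renormalised; this needs mass outside `x`, so
    -- the Dirac case is separate.
    by_cases h0 : (ρ : Measure X) {x}ᶜ = 0
    · have : ρ = diracProba x := by
        ext t ht
        simp only [diracProba, ProbabilityMeasure.coe_mk, Measure.dirac_apply' _ ht]
        by_cases hxt : x ∈ t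
        · simp only [hxt, Set.indicator_of_mem, Pi.one_apply]
          rw [← prob_compl_eq_zero_iff ht]
          exact measure_mono_null (Set.compl_subset_compl.2 (by simpa using hxt)) h0
        · simp only [hxt, not_false_eq_true, Set.indicator_of_notMem]
          refine measure_mono_null (fun y hy => ?_) h0
          rintro rfl
          exact hxt hy
      rw [this, hd]
    · set b : NNReal := ρ {x}ᶜ with hb
      set a : NNReal := ρ {x} with ha
      have hbe : (b : ENNReal) = (ρ : Measure X) {x}ᶜ := by simp [hb]
      have hae : (a : ENNReal) = (ρ : Measure X) {x} := by simp [ha]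
      have hb0 : b ≠ 0 := by
        intro h; rw [h] at hbe; exact h0 hbe.symm
      have hab : a + b = 1 := by
        have := prob_add_prob_compl (μ := (ρ : Measure X)) (measurableSet_singleton x)
        rw [← hae, ← hbe] at this
        exact_mod_cast this
      let ν : ProbabilityMeasure X := ⟨b⁻¹ • (ρ : Measure X).restrict {x}ᶜ, ⟨by
        rw [Measure.smul_apply, Measure.restrict_apply_univ, ← hbe]
        change ((b⁻¹ : NNReal) : ENNReal) * b = 1
        rw [← ENNReal.coe_mul, inv_mul_cancel₀ hb0, ENNReal.coe_one]⟩⟩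
      have hν : (ν : Measure X) = b⁻¹ • (ρ : Measure X).restrict {x}ᶜ := rfl
      have hdec : (ρ : Measure X) = a • (diracProba x : Measure X) + b • (ν : Measure X) := by
        rw [hν, smul_smul, mul_inv_cancel₀ hb0, one_smul]
        conv_lhs => rw [← Measure.restrict_add_restrict_compl (μ := (ρ : Measure X))
          (measurableSet_singleton x)]
        congr 1
        rw [Measure.restrict_singleton, ← hae]
        rfl
      have hν0 : (ν : Measure X) (s : Set X)ᶜ = 0 := by
        rw [hν, Measure.smul_apply, Measure.restrict_apply s.finite_toSet.measurableSet.compl]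
        have : (s : Set X)ᶜ ∩ {x}ᶜ ⊆ ((insert x s : Finset X) : Set X)ᶜ := by
          intro y; simp; tauto
        rw [measure_mono_null this hρ]; simp
      have hint : ∀ τ : ProbabilityMeasure X, ∀ t : Finset X, (τ : Measure X) (t : Set X)ᶜ = 0 →
          Integrable f (τ : Measure X) := by
        intro τ t ht
        refine Integrable.of_bound hfm.aestronglyMeasurable (∑ y ∈ t, |f y|) ?_
        have : ∀ᵐ y ∂(τ : Measure X), y ∈ (t : Set X) := by
          rw [ae_iff]; exact ht
        filter_upwards [this] with y hy
        exact Finset.single_le_sum (f := fun y => |f y|) (fun _ _ => abs_nonneg _) hy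
      rw [hA _ _ _ a b hab hdec, hd, ih ν hν0]
      have h1 : Integrable f (diracProba x : Measure X) := by
        refine hint _ {x} ?_
        simp [diracProba]
      rw [hdec, integral_add_measure (h1.smul_measure_nnreal) ((hint _ _ hν0).smul_measure_nnreal),
        integral_smul_nnreal_measure, integral_smul_nnreal_measure]
      rfl

/-- A continuous affine function on the space of probability measures is given by integration. -/
theorem affine_eq_integral {X : Type*} [TopologicalSpace X] [CompactSpace X]
    [TopologicalSpace.MetrizableSpace X] [MeasurableSpace X] [BorelSpace X]
    (A : ProbabilityMeasure X → ℝ) (hAc : Continuous A)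
    (hA : ∀ (μ ν ρ : ProbabilityMeasure X) (a b : NNReal), a + b = 1 →
      (ρ : Measure X) = a • (μ : Measure X) + b • (ν : Measure X) →
      A ρ = (a : ℝ) * A μ + (b : ℝ) * A ν) (μ : ProbabilityMeasure X) :
    A μ = ∫ x, A (diracProba x) ∂(μ : Measure X) := by
  classical
  have hc : Continuous fun x : X => A (diracProba x) := hAc.comp continuous_diracProba
  obtain ⟨s, hs⟩ := exists_simpleFunc_tendsto_map μ
  have h1 := (hAc.tendsto μ).comp hs
  let f : BoundedContinuousFunction X ℝ := BoundedContinuousFunction.mkOfCompact ⟨_, hc⟩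
  have h2 := (ProbabilityMeasure.tendsto_iff_forall_integral_tendsto.1 hs) f
  refine tendsto_nhds_unique h1 (h2.congr fun n => ?_)
  -- The push-forward under a simple map lives on its finite range, where the integral formula is
  -- known; continuity passes it to the limit.
  refine (affine_eq_integral_of_finite_support A hA (fun x => A (diracProba x)) (fun _ => rfl)
    hc.measurable (s n).range _ ?_).symm
  rw [ProbabilityMeasure.toMeasure_map, Measure.map_apply (s n).measurable
    (s n).range.finite_toSet.measurableSet.compl]
  convert! measure_empty (μ := (μ : Measure X))
  ext x; simp

/-- The linear Stone–Weierstrass property implies affine primality. -/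
theorem HasLSW.isAffinelyPrime.{u, x, y} {G : Type x} [Group G] {X : Type y} [TopologicalSpace X]
    [CompactSpace X] [TopologicalSpace.MetrizableSpace X] [MeasurableSpace X] [BorelSpace X]
    {ψ : G →* (X ≃ₜ X)} (h : HasLSW ψ) : IsAffinelyPrime.{u} ψ := by
  intro E _ _ _ _ _ _ _ S π hπ hS
  obtain ⟨p, hp, q, hq, hpq⟩ := hS
  obtain ⟨l, hl⟩ := geometric_hahn_banach_point_point hpq
  have hA : ∀ ρ : ProbabilityMeasure X,
      l (π ρ : E) = ∫ x, l (π (diracProba x) : E) ∂(ρ : Measure X) := by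
    refine affine_eq_integral (fun ρ => l (π ρ : E))
      (l.continuous.comp (continuous_subtype_val.comp hπ.continuous)) ?_
    intro μ ν ρ a b hab hρ
    simp [hπ.affine μ ν ρ a b hab hρ]
  let f : C(X, ℝ) := ⟨fun x => l (π (diracProba x) : E),
    l.continuous.comp (continuous_subtype_val.comp (hπ.continuous.comp continuous_diracProba))⟩
  have hf : ¬ ∃ c : ℝ, ∀ x, f x = c := by
    rintro ⟨c, hc⟩
    obtain ⟨μ, hμ⟩ := hπ.surjective ⟨p, hp⟩
    obtain ⟨ν, hν⟩ := hπ.surjective ⟨q, hq⟩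
    have key : ∀ ρ : ProbabilityMeasure X, l (π ρ : E) = c := by
      intro ρ
      have hc' : ∀ x, l (π (diracProba x) : E) = c := hc
      rw [hA]; simp [hc']
    have h1 := key μ
    have h2 := key ν
    rw [hμ] at h1
    rw [hν] at h2
    exact hl.ne (h1.trans h2.symm)
  have hd := h f hf
  intro μ ν hμν
  have hint : ∀ (ρ : ProbabilityMeasure X) (k : C(X, ℝ)), Integrable k (ρ : Measure X) := by
    intro ρ k
    exact (BoundedContinuousFunction.mkOfCompact k).integrable _
  let Λ : ProbabilityMeasure X → C(X, ℝ) →ₗ[ℝ] ℝ := fun ρ =>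
    { toFun := fun k => ∫ x, k x ∂(ρ : Measure X)
      map_add' := fun k k' => integral_add (hint ρ k) (hint ρ k')
      map_smul' := fun c k => integral_const_mul c _ }
  have hΛ : ∀ ρ, Continuous (Λ ρ) := by
    intro ρ
    refine AddMonoidHomClass.continuous_of_bound (Λ ρ) 1 fun k => ?_
    rw [one_mul]
    refine (norm_integral_le_of_norm_le_const (C := ‖k‖) (ae_of_all _ k.norm_coe_le_norm)).trans ?_
    simp
  -- The functions with equal integrals against `μ` and `ν`: a closed subspace, to be shown to
  -- contain the generators in LSW.
  let K : Submodule ℝ C(X, ℝ) := LinearMap.ker (Λ μ - Λ ν)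
  have hK : IsClosed (K : Set C(X, ℝ)) := by
    have : (K : Set C(X, ℝ)) = {k | Λ μ k = Λ ν k} := by
      ext k; simp [K, sub_eq_zero]
    rw [this]
    exact isClosed_eq (hΛ μ) (hΛ ν)
  have hle : Submodule.span ℝ
      (Set.range (fun g : G => f.comp (ψ g : C(X, X))) ∪ {(1 : C(X, ℝ))}) ≤ K := by
    rw [Submodule.span_le]
    rintro k (⟨g, rfl⟩ | hk)
    -- By equivariance the integral of a translate of `f` depends on `ρ` only through `π ρ`.
    · have key : ∀ ρ : ProbabilityMeasure X,
          Λ ρ (f.comp (ψ g : C(X, X))) = l (S.act g (π ρ) : E) := by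
        intro ρ
        rw [← hπ.equivariant, hA, pushProba, ProbabilityMeasure.toMeasure_map, integral_map]
        · rfl
        · exact (ψ g).continuous.measurable.aemeasurable
        · exact f.continuous.aestronglyMeasurable
      simp only [K, SetLike.mem_coe, LinearMap.mem_ker, LinearMap.sub_apply, key, hμν, sub_self]
    · rw [Set.mem_singleton_iff.1 hk]
      simp [K, Λ]
  have htop : ∀ k, k ∈ K := by
    intro k
    have := Submodule.topologicalClosure_minimal _ hle hK
    rw [hd] at this
    exact this trivial
  refine Subtype.ext (ext_of_forall_integral_eq_of_IsFiniteMeasure (μ := (μ : Measure X))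
    (ν := (ν : Measure X)) fun k => ?_)
  have := htop k.toContinuousMap
  simpa [K, Λ, sub_eq_zero] using this

/-! ### Rotations of Z/p -/

@[simp] theorem cascade_ofAdd_one {X : Type*} [TopologicalSpace X] (T : X ≃ₜ X) :
    cascade T (Multiplicative.ofAdd 1) = T := by
  simp [cascade]

theorem zmodShift_zpow_apply (p : ℕ) (n : ℤ) (x : ZMod p) : (zmodShift p ^ n) x = x + n := by
  induction n using Int.induction_on generalizing x with
  | zero => simp
  | succ i ih =>
    rw [zpow_add_one, Homeomorph.mul_apply, ih]
    simp [zmodShift, add_comm, add_left_comm]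
  | pred i ih =>
    rw [zpow_sub_one, Homeomorph.mul_apply, ih]
    simp [zmodShift, Homeomorph.inv_apply, Homeomorph.addRight_symm, sub_eq_add_neg, add_comm,
      add_left_comm]

theorem cascade_zmodShift_apply (p : ℕ) (g : Multiplicative ℤ) (x : ZMod p) :
    cascade (zmodShift p) g x = x + (Multiplicative.toAdd g : ℤ) := by
  rw [cascade, zpowersHom_apply, zmodShift_zpow_apply]

/-- The rotation of a cyclic group of prime order is prime. -/
theorem isPrimeSystem_zmodShift.{u} {p : ℕ} (hp : p.Prime) :
    IsPrimeSystem.{u} (cascade (zmodShift p)) := by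
  have : Fact p.Prime := ⟨hp⟩
  intro Y _ _ _ φ π hπ hY a b hab
  by_contra hne
  obtain ⟨u, v, huv⟩ := exists_pair_ne Y
  -- One collision of `a` and `b` makes `b - a` a period of `π`; a non-zero element generates Z/p,
  -- so `π` would be constant.
  have hstep : ∀ x, π x = π (x + (b - a)) := by
    intro x
    obtain ⟨n, hn⟩ := ZMod.intCast_surjective (x - a)
    have h1 := hπ.equivariant (Multiplicative.ofAdd n) a
    have h2 := hπ.equivariant (Multiplicative.ofAdd n) b
    rw [cascade_zmodShift_apply, toAdd_ofAdd, hn] at h1 h2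
    rw [show x = a + (x - a) by ring, h1, hab, ← h2]
    congr 1; ring
  have hmul : ∀ (k : ℕ) x, π x = π (x + k * (b - a)) := by
    intro k
    induction k with
    | zero => simp
    | succ k ih =>
      intro x
      rw [ih, hstep]
      congr 1; push_cast; ring
  have hconst : ∀ x y, π x = π y := by
    intro x y
    have hd : b - a ≠ 0 := sub_ne_zero.2 (Ne.symm hne)
    rw [hmul ((y - x) / (b - a)).val x, ZMod.natCast_zmod_val, div_mul_cancel₀ _ hd]
    congr 1; ring
  obtain ⟨x, rfl⟩ := hπ.surjective u
  obtain ⟨y, rfl⟩ := hπ.surjective v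
  exact huv (hconst x y)

theorem hasLSW_zmodShift_two : HasLSW (cascade (zmodShift 2)) := by
  intro f hf
  rw [eq_top_iff]
  refine le_trans (fun h _ => ?_) (Submodule.le_topologicalClosure _)
  have hne : f 0 - f 1 ≠ 0 := by
    refine fun h0 => hf ⟨f 0, fun x => ?_⟩
    fin_cases x
    · rfl
    · exact (sub_eq_zero.1 h0).symm
  have key : h = ((h 0 - h 1) / (f 0 - f 1)) • f.comp (cascade (zmodShift 2) 1 : C(ZMod 2, ZMod 2))
      + (h 1 - (h 0 - h 1) / (f 0 - f 1) * f 1) • (1 : C(ZMod 2, ℝ)) := by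
    ext x
    simp only [map_one, ContinuousMap.add_apply, ContinuousMap.smul_apply, ContinuousMap.comp_apply,
      ContinuousMap.one_apply, smul_eq_mul, mul_one, ContinuousMap.coe_coe, Homeomorph.one_apply]
    fin_cases x
    · change h 0 = _ * f 0 + (h 1 - _ * f 1)
      field_simp; ring
    · change h 1 = _ * f 1 + (h 1 - _ * f 1)
      ring
  rw [key]
  exact add_mem (Submodule.smul_mem _ _ (Submodule.subset_span (Or.inl ⟨1, rfl⟩)))
    (Submodule.smul_mem _ _ (Submodule.subset_span (Or.inr rfl)))

/-- The functions of mean zero on Z/3 form a plane, and a non-zero one is linearly independent of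
its shift, since a rotation by a third of a turn has no real eigenvector. -/
theorem hasLSW_zmodShift_three : HasLSW (cascade (zmodShift 3)) := by
  intro f hf
  rw [eq_top_iff]
  refine le_trans (fun h _ => ?_) (Submodule.le_topologicalClosure _)
  set m := (f 0 + f 1 + f 2) / 3 with hm
  set k := (h 0 + h 1 + h 2) / 3 with hk
  -- The determinant of the equations at 0 and 1 for writing `h - k` as a combination of `f - m` and
  -- its shift. It is a negative definite quadratic form in the differences of the values of `f`,
  -- and `α`, `β` come from Cramer's rule.
  set D := (f 0 - m) * (f 2 - m) - (f 1 - m) * (f 1 - m) with hD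
  have hne : D ≠ 0 := by
    have hD' : D = -((f 0 - f 1) ^ 2 + (f 1 - f 2) ^ 2 + (f 2 - f 0) ^ 2) / 6 := by
      rw [hD, hm]; ring
    intro h0
    rw [hD'] at h0
    have h1 : f 0 - f 1 = 0 := by
      nlinarith [sq_nonneg (f 0 - f 1), sq_nonneg (f 1 - f 2), sq_nonneg (f 2 - f 0)]
    have h2 : f 2 - f 0 = 0 := by
      nlinarith [sq_nonneg (f 0 - f 1), sq_nonneg (f 1 - f 2), sq_nonneg (f 2 - f 0)]
    refine hf ⟨f 0, fun x => ?_⟩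
    fin_cases x
    · rfl
    · exact (sub_eq_zero.1 h1).symm
    · exact sub_eq_zero.1 h2
  set α := ((h 0 - k) * (f 2 - m) - (h 1 - k) * (f 1 - m)) / D with hα
  set β := ((f 0 - m) * (h 1 - k) - (f 1 - m) * (h 0 - k)) / D with hβ
  have e0 : α * (f 0 - m) + β * (f 1 - m) = h 0 - k := by
    rw [hα, hβ]; field_simp; rw [hD]; ring
  have e1 : α * (f 1 - m) + β * (f 2 - m) = h 1 - k := by
    rw [hα, hβ]; field_simp; rw [hD]; ring
  -- The equation at 2 follows from the other two because both sides have mean zero.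
  have e2 : α * (f 2 - m) + β * (f 0 - m) = h 2 - k := by
    have s1 : f 2 - m = -(f 0 - m) - (f 1 - m) := by rw [hm]; ring
    have s2 : h 2 - k = -(h 0 - k) - (h 1 - k) := by rw [hk]; ring
    rw [s2, ← e0, ← e1, s1]; ring
  have key : h = α • f.comp (cascade (zmodShift 3) 1 : C(ZMod 3, ZMod 3))
      + β • f.comp (cascade (zmodShift 3) (Multiplicative.ofAdd 1) : C(ZMod 3, ZMod 3))
      + (k - (α + β) * m) • (1 : C(ZMod 3, ℝ)) := by
    ext x
    simp only [map_one, ContinuousMap.add_apply, ContinuousMap.smul_apply, ContinuousMap.comp_apply,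
      ContinuousMap.one_apply, smul_eq_mul, mul_one, ContinuousMap.coe_coe, Homeomorph.one_apply,
      cascade_ofAdd_one, zmodShift, Homeomorph.coe_addRight]
    fin_cases x
    · change h 0 = α * f 0 + β * f 1 + _
      linarith
    · change h 1 = α * f 1 + β * f 2 + _
      linarith
    · change h 2 = α * f 2 + β * f 0 + _
      linarith
  rw [key]
  exact add_mem (add_mem (Submodule.smul_mem _ _ (Submodule.subset_span (Or.inl ⟨_, rfl⟩)))
    (Submodule.smul_mem _ _ (Submodule.subset_span (Or.inl ⟨_, rfl⟩))))
    (Submodule.smul_mem _ _ (Submodule.subset_span (Or.inr rfl)))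

/-- The convex combination `a μ + b ν` of two probability measures. -/
noncomputable def mixProba {X : Type*} [MeasurableSpace X] (a b : NNReal) (hab : a + b = 1)
    (μ ν : ProbabilityMeasure X) : ProbabilityMeasure X :=
  ⟨a • (μ : Measure X) + b • (ν : Measure X), ⟨by
    simp only [Measure.add_apply, Measure.smul_apply, measure_univ]
    change (a : ENNReal) * 1 + (b : ENNReal) * 1 = 1
    rw [mul_one, mul_one]
    exact_mod_cast hab⟩⟩

section Character

variable (p : ℕ) [NeZero p]

/-- The integral of the standard additive character against a probability measure on `ZMod p`. -/
noncomputable def charIntegral (μ : ProbabilityMeasure (ZMod p)) : PUnit.{z+1} → ℂ :=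
  fun _ => ∫ x, ZMod.stdAddChar x ∂(μ : Measure (ZMod p))

theorem continuous_charIntegral : Continuous (charIntegral.{z} p) := by
  refine continuous_pi fun _ => ?_
  let r : BoundedContinuousFunction (ZMod p) ℝ :=
    BoundedContinuousFunction.mkOfCompact
      ⟨fun x => (ZMod.stdAddChar x).re, continuous_of_discreteTopology⟩
  let i : BoundedContinuousFunction (ZMod p) ℝ :=
    BoundedContinuousFunction.mkOfCompact
      ⟨fun x => (ZMod.stdAddChar x).im, continuous_of_discreteTopology⟩
  have h := ((Complex.continuous_ofReal.comp
      (ProbabilityMeasure.continuous_integral_boundedContinuousFunction r)).add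
    ((Complex.continuous_ofReal.comp
      (ProbabilityMeasure.continuous_integral_boundedContinuousFunction i)).mul
      (continuous_const (y := Complex.I))))
  refine h.congr fun μ => ?_
  exact integral_re_add_im (𝕜 := ℂ) (f := fun x => ZMod.stdAddChar x) (μ := (μ : Measure (ZMod p)))
    Integrable.of_finite

theorem charIntegral_of_eq {μ ν ρ : ProbabilityMeasure (ZMod p)} {a b : NNReal}
    (h : (ρ : Measure (ZMod p)) = a • (μ : Measure (ZMod p)) + b • (ν : Measure (ZMod p))) :
    charIntegral.{z} p ρ = (a : ℝ) • charIntegral.{z} p μ + (b : ℝ) • charIntegral.{z} p ν := by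
  funext u
  simp only [charIntegral, Pi.add_apply, Pi.smul_apply]
  rw [h, integral_add_measure Integrable.of_finite Integrable.of_finite,
    integral_smul_nnreal_measure, integral_smul_nnreal_measure]
  rfl

theorem charIntegral_pushProba (g : Multiplicative ℤ) (μ : ProbabilityMeasure (ZMod p)) :
    charIntegral.{z} p (pushProba (cascade (zmodShift p) g) μ) =
      (ZMod.stdAddChar ((Multiplicative.toAdd g : ℤ) : ZMod p)) • charIntegral.{z} p μ := by
  funext u
  simp only [charIntegral, Pi.smul_apply, smul_eq_mul]
  rw [pushProba, ProbabilityMeasure.toMeasure_map, integral_map]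
  · simp only [cascade_zmodShift_apply, AddChar.map_add_eq_mul]
    rw [integral_mul_const, mul_comm]
  · exact (Homeomorph.continuous _).measurable.aemeasurable
  · exact AEStronglyMeasurable.of_discrete

/-- Multiplication by an additive character on the range of `charIntegral`. -/
noncomputable def charHomeo :
    Multiplicative ℤ →* (Set.range (charIntegral.{z} p) ≃ₜ Set.range (charIntegral.{z} p)) :=
  have hmem : ∀ (g : Multiplicative ℤ) (q : Set.range (charIntegral.{z} p)),
      (ZMod.stdAddChar ((Multiplicative.toAdd g : ℤ) : ZMod p)) • (q : PUnit.{z+1} → ℂ) ∈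
        Set.range (charIntegral.{z} p) := by
    rintro g ⟨_, μ, rfl⟩
    exact ⟨_, charIntegral_pushProba p g μ⟩
  have hinv : ∀ (g h : Multiplicative ℤ) (q : PUnit.{z+1} → ℂ), g * h = 1 →
      (ZMod.stdAddChar ((Multiplicative.toAdd g : ℤ) : ZMod p)) •
      (ZMod.stdAddChar ((Multiplicative.toAdd h : ℤ) : ZMod p)) • q = q := by
    intro g h q hgh
    rw [smul_smul, ← AddChar.map_add_eq_mul, ← Int.cast_add, ← toAdd_mul, hgh]
    simp
  { toFun := fun g =>
      { toFun := fun q => ⟨_, hmem g q⟩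
        invFun := fun q => ⟨_, hmem g⁻¹ q⟩
        left_inv := fun q => Subtype.ext (hinv _ _ _ (inv_mul_cancel g))
        right_inv := fun q => Subtype.ext (hinv _ _ _ (mul_inv_cancel g))
        continuous_toFun := by fun_prop
        continuous_invFun := by fun_prop }
    map_one' := by
      ext q : 2
      simp
    map_mul' := fun g h => by
      ext q : 2
      simp [AddChar.map_add_eq_mul, mul_smul] }

/-- The affine system of barycentres of the `p`-th roots of unity. -/
noncomputable def charSystem : AffineSystem (Multiplicative ℤ) (PUnit.{z+1} → ℂ) where
  carrier := Set.range (charIntegral.{z} p)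
  isCompact := isCompact_range (continuous_charIntegral p)
  convex := by
    rintro _ ⟨μ, rfl⟩ _ ⟨ν, rfl⟩ a b ha hb hab
    lift a to NNReal using ha
    lift b to NNReal using hb
    exact ⟨mixProba a b (by exact_mod_cast hab) μ ν, charIntegral_of_eq p rfl⟩
  metrizable := inferInstance
  act := charHomeo p
  affine := by
    intro g q r s a b _ _ _ h
    change _ • (s : PUnit.{z+1} → ℂ) = a • _ • (q : PUnit.{z+1} → ℂ) + b • _ • (r : PUnit.{z+1} → ℂ)
    rw [h, smul_add, smul_comm a, smul_comm b]

/-- A regular polygon with at least five vertices is not a simplex: with ζ = exp(2πi/p), the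
midpoint of ζ and ζ⁻¹ lies in the triangle with vertices 1, ζ² and ζ⁻², so two different measures
have the same barycentre. -/
theorem not_isAffinelyPrime_zmodShift (hp : p.Prime) (h2 : p ≠ 2) (h3 : p ≠ 3) :
    ¬ IsAffinelyPrime.{z} (cascade (zmodShift p)) := by
  have hp4 : 4 ≤ p := by
    have := hp.two_le
    omega
  intro h
  -- Functions on `PUnit.{z+1}` are a copy of ℂ in the universe over which affine primality
  -- quantifies.
  have hinj := h (PUnit.{z+1} → ℂ) (charSystem.{z} p) (fun μ => ⟨charIntegral p μ, μ, rfl⟩)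
    { continuous := (continuous_charIntegral p).subtype_mk _
      surjective := by
        rintro ⟨_, μ, rfl⟩
        exact ⟨μ, rfl⟩
      equivariant := fun g μ => Subtype.ext (charIntegral_pushProba p g μ)
      affine := fun μ ν ρ a b _ hρ => charIntegral_of_eq p hρ } ?_
  · have hd : ∀ x, charIntegral.{z} p (diracProba x) = fun _ => ZMod.stdAddChar x := by
      intro x; funext u; simp [charIntegral, diracProba]
    set θ : ℝ := 2 * Real.pi / p with hθ
    set c := Real.cos θ with hc
    have hc0 : 0 ≤ c := by
      have hp' : (4 : ℝ) ≤ p := by exact_mod_cast hp4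
      apply Real.cos_nonneg_of_mem_Icc
      constructor
      · have : 0 ≤ θ := by positivity
        linarith [Real.pi_pos]
      · rw [hθ, div_le_div_iff₀ (by linarith) (by norm_num)]
        nlinarith [Real.pi_pos]
    have hhalf : (2⁻¹ : NNReal) + 2⁻¹ = 1 := by
      rw [← NNReal.coe_inj]; push_cast; norm_num
    -- The midpoints of ζ^(±1) and ζ^(±2) are `c` and 2c² - 1. The weight `t` solves t + (1 - t)(2c²
    -- - 1) = c; `c ≥ 0`, from `p ≥ 4`, makes it non-negative.
    let t : NNReal := ⟨(1 + 2 * c) / (2 * (1 + c)), by positivity⟩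
    let t' : NNReal := ⟨1 / (2 * (1 + c)), by positivity⟩
    have ht : t + t' = 1 := by
      rw [← NNReal.coe_inj]
      change (1 + 2 * c) / (2 * (1 + c)) + 1 / (2 * (1 + c)) = 1
      have : 1 + c ≠ 0 := by positivity
      field_simp; ring
    let μ := mixProba 2⁻¹ 2⁻¹ hhalf (diracProba (1 : ZMod p)) (diracProba (-1 : ZMod p))
    let ν := mixProba t t' ht (diracProba (0 : ZMod p))
      (mixProba 2⁻¹ 2⁻¹ hhalf (diracProba (2 : ZMod p)) (diracProba (-2 : ZMod p)))
    have hexp : ∀ j : ℤ, (ZMod.stdAddChar ((j : ZMod p)) : ℂ)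
        = Complex.cos ((j * θ : ℝ) : ℂ) + Complex.sin ((j * θ : ℝ) : ℂ) * Complex.I := by
      intro j
      rw [ZMod.stdAddChar_coe, ← Complex.exp_mul_I]
      congr 1; rw [hθ]; push_cast; ring
    have e1 := hexp 1
    have e2 := hexp (-1)
    have e3 := hexp 2
    have e4 := hexp (-2)
    push_cast at e1 e2 e3 e4
    have hμν : charIntegral.{z} p μ = charIntegral.{z} p ν := by
      rw [charIntegral_of_eq p (ρ := μ) rfl, charIntegral_of_eq p (ρ := ν) rfl,
        charIntegral_of_eq p (ρ := mixProba 2⁻¹ 2⁻¹ hhalf (diracProba (2 : ZMod p))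
          (diracProba (-2 : ZMod p))) rfl]
      funext u
      simp only [hd, Pi.add_apply, Pi.smul_apply, AddChar.map_zero_eq_one, e1, e2, e3, e4]
      have hcc : Complex.cos (θ : ℂ) = (c : ℂ) := by rw [hc]; simp
      have h1c : (1 + c : ℂ) ≠ 0 := by
        have : (1 + c : ℝ) ≠ 0 := by positivity
        exact_mod_cast this
      have htc : ((t : ℝ) : ℂ) = (1 + 2 * c) / (2 * (1 + c)) := by
        change (((1 + 2 * c) / (2 * (1 + c)) : ℝ) : ℂ) = _
        push_cast; rfl
      have htc' : ((t' : ℝ) : ℂ) = 1 / (2 * (1 + c)) := by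
        change ((1 / (2 * (1 + c)) : ℝ) : ℂ) = _
        push_cast; rfl
      simp only [one_mul, neg_mul, Complex.cos_neg, Complex.sin_neg, Complex.cos_two_mul,
        Complex.real_smul, htc, htc', hcc]
      push_cast
      field_simp
      ring
    have heq : μ = ν := hinj (Subtype.ext hμν)
    -- The residue 1 is an atom of `μ` but not of `ν`; -2 = 1 is excluded by `p ≠ 3`.
    have n2 : (2 : ZMod p) ≠ 1 := by
      intro h
      have : Fact (1 < p) := ⟨hp.one_lt⟩
      have : (1 : ZMod p) = 0 := by linear_combination h
      exact one_ne_zero this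
    have n3 : (-2 : ZMod p) ≠ 1 := by
      intro h
      have : ((3 : ℕ) : ZMod p) = 0 := by push_cast; linear_combination -h
      rw [ZMod.natCast_eq_zero_iff] at this
      exact h3 ((Nat.prime_dvd_prime_iff_eq hp Nat.prime_three).1 this)
    have n0 : (0 : ZMod p) ≠ 1 := by
      have : Fact (1 < p) := ⟨hp.one_lt⟩
      exact zero_ne_one
    have hm : (μ : Measure (ZMod p)) {1} = (ν : Measure (ZMod p)) {1} := by rw [heq]
    have hν : (ν : Measure (ZMod p)) {1} = 0 := by
      simp [ν, mixProba, diracProba, n0, n2, n3]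
    have hμ : (μ : Measure (ZMod p)) {1} ≠ 0 := by
      simp [μ, mixProba, diracProba]
    exact hμ (hm.trans hν)
  · refine ⟨_, ⟨diracProba 0, rfl⟩, _, ⟨diracProba 1, rfl⟩, fun h => ?_⟩
    have h1 := congrFun h PUnit.unit
    simp only [charIntegral, diracProba, ProbabilityMeasure.coe_mk, integral_dirac] at h1
    have : Fact (1 < p) := ⟨hp.one_lt⟩
    exact zero_ne_one (ZMod.injective_stdAddChar h1)

end Character

theorem isAffinelyPrime_zmodShift_iff.{u} {p : ℕ} (hp : p.Prime) :
    IsAffinelyPrime.{u} (cascade (zmodShift p)) ↔ p = 2 ∨ p = 3 := by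
  have : NeZero p := ⟨hp.ne_zero⟩
  constructor
  · intro h
    by_contra! hne
    exact not_isAffinelyPrime_zmodShift.{u} p hp hne.1 hne.2 h
  · rintro (rfl | rfl)
    · exact hasLSW_zmodShift_two.isAffinelyPrime
    · exact hasLSW_zmodShift_three.isAffinelyPrime

/-! ### Closed invariant subspaces on the one-point compactification of a Euclidean space -/

/-- The linear Stone–Weierstrass property can be checked on closed invariant subspaces, after
transport along a homeomorphism. -/
theorem hasLSW_of_closed_invariant {G : Type*} [Group G] {X Y : Type*} [TopologicalSpace X]
    [CompactSpace X] [TopologicalSpace Y] [CompactSpace Y] (ψ : G →* (X ≃ₜ X)) (Φ : Y ≃ₜ X)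
    (h : ∀ W : Submodule ℝ C(Y, ℝ), IsClosed (W : Set C(Y, ℝ)) → (1 : C(Y, ℝ)) ∈ W →
      (∀ g : G, ∀ k ∈ W, k.comp (((Φ.trans (ψ g)).trans Φ.symm : Y ≃ₜ Y) : C(Y, Y)) ∈ W) →
      (∃ f ∈ W, ¬ ∃ c : ℝ, ∀ y, f y = c) → W = ⊤) : HasLSW ψ := by
  intro f hf
  set S := Submodule.span ℝ
      (Set.range (fun g : G => f.comp (ψ g : C(X, X))) ∪ {(1 : C(X, ℝ))}) with hS
  have hinv : ∀ g : G, ∀ k ∈ S.topologicalClosure,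
      k.comp (ψ g : C(X, X)) ∈ S.topologicalClosure := by
    intro g k hk
    have hmaps : Set.MapsTo (fun k : C(X, ℝ) => k.comp (ψ g : C(X, X))) (S : Set C(X, ℝ)) S := by
      intro k hk
      induction hk using Submodule.span_induction with
      | mem k hk =>
        rcases hk with ⟨g', rfl⟩ | hk
        · refine Submodule.subset_span (Or.inl ⟨g' * g, ?_⟩)
          ext x
          simp
        · refine Submodule.subset_span (Or.inr ?_)
          rw [Set.mem_singleton_iff] at hk ⊢
          rw [hk]; rfl
      | zero => exact S.zero_mem
      | add a b _ _ ha hb => exact S.add_mem ha hb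
      | smul c a _ ha => exact S.smul_mem c ha
    exact map_mem_closure (f := fun k : C(X, ℝ) => k.comp (ψ g : C(X, X))) 
      (ContinuousMap.continuous_precomp _) hk hmaps
  let P : C(Y, ℝ) →ₗ[ℝ] C(X, ℝ) :=
    { toFun := fun k => k.comp (Φ.symm : C(X, Y))
      map_add' := fun _ _ => rfl
      map_smul' := fun _ _ => rfl }
  have hW := h (S.topologicalClosure.comap P)
    ((Submodule.isClosed_topologicalClosure S).preimage
      (ContinuousMap.continuous_precomp (Φ.symm : C(X, Y)))) ?_ ?_ ?_
  · rw [eq_top_iff]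
    intro k _
    have hk : k.comp (Φ : C(Y, X)) ∈ S.topologicalClosure.comap P := by rw [hW]; trivial
    have : P (k.comp (Φ : C(Y, X))) = k := by ext x; simp [P]
    rw [← this]; exact hk
  · exact Submodule.le_topologicalClosure _ (Submodule.subset_span (Or.inr rfl))
  · intro g k hk
    have := hinv g _ hk
    rw [Submodule.mem_comap]
    convert! this using 1
    ext x
    simp [P]
  · refine ⟨f.comp (Φ : C(Y, X)), ?_, ?_⟩
    · refine Submodule.le_topologicalClosure _ (Submodule.subset_span (Or.inl ⟨1, ?_⟩))
      ext x
      simp [P]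
    · rintro ⟨c, hc⟩
      exact hf ⟨c, fun x => by simpa using hc (Φ.symm x)⟩

section Radial

variable {E : Type*} [NormedAddCommGroup E] [InnerProductSpace ℝ E]

/-- The homeomorphism `z ↦ ‖z‖ ^ m • z`. -/
noncomputable def normPowHomeo (E : Type*) [NormedAddCommGroup E] [InnerProductSpace ℝ E] (m : ℕ) :
    E ≃ₜ E where
  toFun z := ‖z‖ ^ m • z
  -- If w = ‖z‖^m • z then ‖w‖ = ‖z‖^(m+1), which gives the exponent. The value of the power at 0 is
  -- immaterial, as it multiplies the zero vector.
  invFun w := (‖w‖ ^ (-(m / (m + 1) : ℝ))) • w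
  left_inv z := by
    rcases eq_or_ne z 0 with rfl | hz
    · simp
    · have hz' : 0 < ‖z‖ := norm_pos_iff.2 hz
      simp only [norm_smul, norm_pow, norm_norm]
      rw [← pow_succ, smul_smul, ← Real.rpow_natCast, ← Real.rpow_mul hz'.le, ← Real.rpow_natCast,
        ← Real.rpow_add hz']
      have : (((m + 1 : ℕ) : ℝ) * -(m / (m + 1) : ℝ) + m) = 0 := by
        have : (m + 1 : ℝ) ≠ 0 := by positivity
        push_cast; field_simp; ring
      rw [this, Real.rpow_zero, one_smul]
  right_inv w := by
    rcases eq_or_ne w 0 with rfl | hw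
    · simp
    · have hw' : 0 < ‖w‖ := norm_pos_iff.2 hw
      simp only [norm_smul]
      rw [Real.norm_of_nonneg (Real.rpow_nonneg hw'.le _), smul_smul]
      conv_lhs => enter [1, 1, 1, 2]; rw [← Real.rpow_one ‖w‖]
      rw [← Real.rpow_add hw', ← Real.rpow_natCast, ← Real.rpow_mul hw'.le, ← Real.rpow_add hw']
      have : ((-(m / (m + 1) : ℝ) + 1) * m + -(m / (m + 1) : ℝ)) = 0 := by
        have : (m + 1 : ℝ) ≠ 0 := by positivity
        field_simp; ring
      rw [this, Real.rpow_zero, one_smul]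
  continuous_toFun := by fun_prop
  continuous_invFun := by
    rw [continuous_iff_continuousAt]
    intro w
    rcases eq_or_ne w 0 with rfl | hw
    -- The factor may blow up at 0, but the norm of the image is ‖w‖^(1/(m+1)) for `w ≠ 0`.
    · rw [ContinuousAt, smul_zero]
      have hm : (0 : ℝ) < 1 / (m + 1) := by positivity
      have h : Tendsto (fun w : E => ‖w‖ ^ (1 / (m + 1) : ℝ)) (𝓝 0) (𝓝 0) := by
        have h1 : ContinuousAt (fun w : E => ‖w‖ ^ (1 / (m + 1) : ℝ)) 0 :=
          continuous_norm.continuousAt.rpow_const (Or.inr hm.le)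
        rw [ContinuousAt, norm_zero, Real.zero_rpow hm.ne'] at h1
        exact h1
      refine squeeze_zero_norm (fun w => ?_) h
      rcases eq_or_ne w 0 with rfl | hw
      · simp [Real.zero_rpow_nonneg]
      · have hw' : 0 < ‖w‖ := norm_pos_iff.2 hw
        rw [norm_smul, Real.norm_of_nonneg (Real.rpow_nonneg hw'.le _)]
        conv_lhs => enter [2]; rw [← Real.rpow_one ‖w‖]
        rw [← Real.rpow_add hw']
        apply le_of_eq
        congr 1
        field_simp; ring
    · exact (continuous_norm.continuousAt.rpow_const (Or.inl (norm_ne_zero_iff.2 hw))).smul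
        continuousAt_id

/-- The homeomorphism `z ↦ r • (z - a)`. -/
noncomputable def affineHomeo (a : E) (r : ℝ) (hr : r ≠ 0) : E ≃ₜ E :=
  (Homeomorph.subRight a).trans (Homeomorph.smulOfNeZero r hr)

variable [FiniteDimensional ℝ E]

/-- The function `exp (-‖z‖ ^ 2)` on the one-point compactification. -/
noncomputable def onePointGaussian (E : Type*) [NormedAddCommGroup E] [InnerProductSpace ℝ E]
    [FiniteDimensional ℝ E] : C(OnePoint E, ℝ) :=
  OnePoint.continuousMapMk ⟨fun z => Real.exp (-‖z‖ ^ 2), by fun_prop⟩ 0 (by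
    rw [coclosedCompact_eq_cocompact]
    have := FiniteDimensional.proper ℝ E
    refine Real.tendsto_exp_neg_atTop_nhds_zero.comp ?_
    exact (tendsto_pow_atTop two_ne_zero).comp (tendsto_norm_cocompact_atTop (E := E)))

@[simp] theorem onePointGaussian_coe (z : E) : onePointGaussian E z = Real.exp (-‖z‖ ^ 2) := rfl

@[simp] theorem onePointGaussian_infty : onePointGaussian E OnePoint.infty = 0 := rfl

/-- The terms telescope: each is min x (j+1) - min x j. This is the layer-cake decomposition used to
rebuild the Gaussian from its level sets. -/
theorem sum_clamp_sub (x : ℝ) (hx : 0 ≤ x) (n : ℕ) :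
    ∑ j ∈ Finset.range n, max 0 (min 1 (x - j)) = min x n := by
  induction n with
  | zero => simp [hx]
  | succ n ih =>
    rw [Finset.sum_range_succ, ih]
    push_cast
    rcases le_total x n with h | h
    · rw [min_eq_left h, max_eq_left, min_eq_left (by linarith), add_zero]
      exact (min_le_right _ _).trans (by linarith)
    · rcases le_total x (n + 1) with h' | h'
      · rw [min_eq_right h, min_eq_left h', min_eq_right (by linarith), max_eq_right (by linarith)]
        ring
      · rw [min_eq_right h, min_eq_right h', min_eq_left (by linarith), max_eq_right (by linarith)]

/-- A radial homeomorphism concentrating one level set of the Gaussian. -/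
theorem exists_homeo_separating_levels (f : C(OnePoint E, ℝ)) {u v ε : ℝ} (hu : 0 < u) (huv : u < v)
    (hv : v < 1) (hε : 0 < ε) :
    ∃ e : E ≃ₜ E, ∀ z : OnePoint E,
      (v ≤ onePointGaussian E z → |f (e.onePointCongr z) - f ((0 : E) : OnePoint E)| ≤ ε) ∧
      (onePointGaussian E z ≤ u → |f (e.onePointCongr z) - f OnePoint.infty| ≤ ε) := by
  obtain ⟨δ, hδ, h0⟩ : ∃ δ > 0, ∀ w : E, ‖w‖ ≤ δ → |f w - f ((0 : E) : OnePoint E)| ≤ ε := by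
    have hc : Continuous fun w : E => f w := f.continuous.comp OnePoint.continuous_coe
    obtain ⟨δ, hδ, h⟩ := Metric.continuous_iff.1 hc 0 ε hε
    refine ⟨δ / 2, by positivity, fun w hw => (h w ?_).le⟩
    rw [dist_zero_right]; linarith
  obtain ⟨ρ, h1⟩ : ∃ ρ : ℝ, ∀ w : E, ρ ≤ ‖w‖ → |f w - f OnePoint.infty| ≤ ε := by
    have hc := ((OnePoint.continuous_iff (f : OnePoint E → ℝ)).1 f.continuous).1
    rw [coclosedCompact_eq_cocompact] at hc
    have := FiniteDimensional.proper ℝ E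
    have h2 := (Metric.tendsto_nhds.1 hc) ε hε
    rw [← Metric.cobounded_eq_cocompact, ← comap_norm_atTop, eventually_comap, eventually_atTop] at h2
    obtain ⟨ρ, hρ⟩ := h2
    exact ⟨ρ, fun w hw => (hρ _ hw w rfl).le⟩
  have hlv : 0 < -Real.log v := by linarith [Real.log_neg (hu.trans huv) hv]
  -- The Gaussian is at least `v` on the ball of radius `r` and at most `u` outside the ball of
  -- radius `R`.
  set r := Real.sqrt (-Real.log v) with hr
  set R := Real.sqrt (-Real.log u) with hR
  have hr0 : 0 < r := Real.sqrt_pos.2 hlv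
  have hrR : r < R := Real.sqrt_lt_sqrt hlv.le (by linarith [Real.log_lt_log hu huv])
  -- The exponent is so large that a radial power map taking radius `r` to `δ` takes radius `R`
  -- beyond `ρ`.
  obtain ⟨m, hm⟩ := pow_unbounded_of_one_lt (ρ / δ) ((one_lt_div hr0).2 hrR)
  have hm' : ρ / δ < (R / r) ^ (m + 1) :=
    hm.trans_le (pow_le_pow_right₀ ((one_lt_div hr0).2 hrR).le (Nat.le_succ m))
  have hc : 0 < δ / r ^ (m + 1) := by positivity
  let e : E ≃ₜ E := (normPowHomeo E m).trans (Homeomorph.smulOfNeZero _ hc.ne')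
  have he : ∀ z : E, ‖e z‖ = δ * (‖z‖ / r) ^ (m + 1) := by
    intro z
    change ‖(δ / r ^ (m + 1)) • ‖z‖ ^ m • z‖ = _
    rw [norm_smul, norm_smul, Real.norm_of_nonneg hc.le, norm_pow, norm_norm, div_pow]
    ring
  refine ⟨e, fun z => ?_⟩
  induction z using OnePoint.rec with
  | infty =>
    refine ⟨fun h => ?_, fun _ => ?_⟩
    · rw [onePointGaussian_infty] at h; linarith
    · change |f OnePoint.infty - _| ≤ _
      simpa using hε.le
  | coe z =>
    refine ⟨fun h => h0 (e z) ?_, fun h => h1 (e z) ?_⟩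
    · rw [onePointGaussian_coe, ← Real.log_le_iff_le_exp (hu.trans huv)] at h
      rw [he]
      have hz : ‖z‖ ≤ r := Real.le_sqrt_of_sq_le (by linarith)
      have : (‖z‖ / r) ^ (m + 1) ≤ 1 := pow_le_one₀ (by positivity) ((div_le_one hr0).2 hz)
      nlinarith
    · rw [onePointGaussian_coe, ← Real.le_log_iff_exp_le hu] at h
      rw [he]
      have hz : R ≤ ‖z‖ := by
        rw [hR, Real.sqrt_le_left (norm_nonneg _)]; linarith
      have h3 : (R / r) ^ (m + 1) ≤ (‖z‖ / r) ^ (m + 1) := by gcongr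
      rw [div_lt_iff₀ hδ] at hm'
      nlinarith

/-- Averages of a function along radial homeomorphisms approximate the Gaussian. -/
theorem onePointGaussian_mem (W : Submodule ℝ C(OnePoint E, ℝ))
    (hW : IsClosed (W : Set C(OnePoint E, ℝ)))
    (hinv : ∀ e : E ≃ₜ E, ∀ k ∈ W,
      k.comp (e.onePointCongr : C(OnePoint E, OnePoint E)) ∈ W)
    (f : C(OnePoint E, ℝ)) (hf : f ∈ W) (hf0 : f ((0 : E) : OnePoint E) = 1)
    (hf1 : f OnePoint.infty = 0) : onePointGaussian E ∈ W := by
  -- Layer cake: the Gaussian is nearly the average of the indicators of its superlevel sets, and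
  -- each indicator is approximated by a translate of `f` except in a thin transition layer.
  have key : ∀ N : ℕ, ∃ k ∈ W, ‖k - onePointGaussian E‖ ≤ (‖f‖ + 2) / (N + 1 : ℝ) := by
    intro N
    have hN : (0 : ℝ) < N + 1 := by positivity
    have hex : ∀ j : ℕ, ∃ e : E ≃ₜ E, j < N + 1 → ∀ z : OnePoint E,
        (j + 1 ≤ (N + 1) * onePointGaussian E z → |f (e.onePointCongr z) - 1| ≤ 1 / (N + 1)) ∧
        ((N + 1) * onePointGaussian E z ≤ j → |f (e.onePointCongr z)| ≤ 1 / (N + 1)) := by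
      intro j
      by_cases hj : j < N + 1
      · have hj' : (j : ℝ) + 1 ≤ N + 1 := by exact_mod_cast hj
        -- Thirds keep the levels strictly between 0 and 1 even for j = 0 and j = N.
        obtain ⟨e, he⟩ := exists_homeo_separating_levels f (u := (j + 1 / 3) / (N + 1))
          (v := (j + 2 / 3) / (N + 1)) (ε := 1 / (N + 1)) (by positivity) (by gcongr; norm_num)
          (by rw [div_lt_one hN]; linarith) (by positivity)
        rw [hf0, hf1] at he
        refine ⟨e, fun _ z => ⟨fun h => (he z).1 ?_, fun h => ?_⟩⟩
        · rw [div_le_iff₀ hN]; linarith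
        · simpa using (he z).2 (by rw [le_div_iff₀ hN]; linarith)
      · exact ⟨Homeomorph.refl E, fun h => absurd h hj⟩
    choose e he using hex
    refine ⟨(1 / (N + 1 : ℝ)) • ∑ j ∈ Finset.range (N + 1),
      f.comp ((e j).onePointCongr : C(OnePoint E, OnePoint E)),
      W.smul_mem _ (W.sum_mem fun j _ => hinv _ _ hf), ?_⟩
    rw [ContinuousMap.norm_le _ (by positivity)]
    intro z
    set x := (N + 1) * onePointGaussian E z with hx
    have hg0 : 0 ≤ onePointGaussian E z := by
      induction z using OnePoint.rec with
      | infty => simp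
      | coe z => simpa using (Real.exp_pos _).le
    have hg1 : onePointGaussian E z ≤ 1 := by
      induction z using OnePoint.rec with
      | infty => simp
      | coe z => simp
    have hx0 : 0 ≤ x := by positivity
    have hsum : ∑ j ∈ Finset.range (N + 1), max 0 (min 1 (x - j)) = x := by
      rw [sum_clamp_sub x hx0, min_eq_left]
      push_cast
      nlinarith
    -- At a given point only the index j = ⌊x⌋ can be in transition; it costs at most ‖f‖ + 1, and
    -- the other errors add up to at most 1.
    have hterm : ∀ j ∈ Finset.range (N + 1),
        |f ((e j).onePointCongr z) - max 0 (min 1 (x - j))| ≤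
          1 / (N + 1) + if j = ⌊x⌋₊ then ‖f‖ + 1 else 0 := by
      intro j hj
      have hpos : (0 : ℝ) ≤ if j = ⌊x⌋₊ then ‖f‖ + 1 else 0 := by
        split_ifs <;> positivity
      by_cases h1 : (j : ℝ) + 1 ≤ x
      · have := (he j (Finset.mem_range.1 hj) z).1 h1
        rw [min_eq_left (by linarith), max_eq_right zero_le_one]
        linarith
      by_cases h2 : x ≤ j
      · have := (he j (Finset.mem_range.1 hj) z).2 h2
        rw [max_eq_left ((min_le_right _ _).trans (by linarith)), sub_zero]
        linarith
      push Not at h1 h2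
      have hjx : j = ⌊x⌋₊ := ((Nat.floor_eq_iff hx0).2 ⟨h2.le, h1⟩).symm
      rw [if_pos hjx, min_eq_right (by linarith), max_eq_right (by linarith)]
      have h3 : |f ((e j).onePointCongr z)| ≤ ‖f‖ := f.norm_coe_le_norm _
      have h4 : |x - j| ≤ 1 := by rw [abs_le]; constructor <;> linarith
      have h5 := abs_sub (f ((e j).onePointCongr z)) (x - j)
      have : (0 : ℝ) ≤ 1 / (N + 1) := by positivity
      linarith
    have hval : ((1 / (N + 1 : ℝ)) • ∑ j ∈ Finset.range (N + 1),
        f.comp ((e j).onePointCongr : C(OnePoint E, OnePoint E)) - onePointGaussian E) z =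
        (1 / (N + 1 : ℝ)) * ∑ j ∈ Finset.range (N + 1),
          (f ((e j).onePointCongr z) - max 0 (min 1 (x - j))) := by
      rw [Finset.sum_sub_distrib, hsum, hx]
      simp only [ContinuousMap.sub_apply, ContinuousMap.smul_apply, ContinuousMap.sum_apply,
        ContinuousMap.comp_apply, ContinuousMap.coe_coe, smul_eq_mul]
      field_simp
    rw [hval, norm_mul, Real.norm_of_nonneg (by positivity), div_mul_eq_mul_div, one_mul]
    gcongr
    refine (Finset.abs_sum_le_sum_abs _ _).trans ((Finset.sum_le_sum hterm).trans ?_)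
    rw [Finset.sum_add_distrib, Finset.sum_const, Finset.card_range, Finset.sum_ite_eq']
    have h6 : (N + 1) • (1 / (N + 1 : ℝ)) = 1 := by
      rw [nsmul_eq_mul]; push_cast; field_simp
    rw [h6]
    split_ifs
    · linarith
    · linarith [norm_nonneg f]
  choose k hk hkn using key
  refine hW.mem_of_tendsto (f := k) (b := atTop) ?_ (Eventually.of_forall hk)
  rw [tendsto_iff_norm_sub_tendsto_zero]
  refine squeeze_zero (fun _ => norm_nonneg _) hkn ?_
  exact tendsto_const_div_atTop_nhds_zero_nat (‖f‖ + 2) |>.comp (tendsto_add_atTop_nat 1) |>.congr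
    fun n => by simp

/-- The set of constants and scaled translates of the Gaussian, up to a real factor. -/
def gaussianSet (E : Type*) [NormedAddCommGroup E] [InnerProductSpace ℝ E]
    [FiniteDimensional ℝ E] : Set C(OnePoint E, ℝ) :=
  {1} ∪ {k | ∃ (c : ℝ) (a : E) (r : ℝ) (hr : r ≠ 0), k = c • (onePointGaussian E).comp
    ((affineHomeo a r hr).onePointCongr : C(OnePoint E, OnePoint E))}

/-- Completing the square: the exponents add to a quadratic centred at the weighted mean of `a` and
`b`, plus a constant that becomes the scalar `c`. -/
theorem gaussian_mul (a b : E) (r s : ℝ) (hr : r ≠ 0) (hs : s ≠ 0) :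
    ∃ (c : ℝ) (m : E) (t : ℝ) (ht : t ≠ 0),
      (onePointGaussian E).comp ((affineHomeo a r hr).onePointCongr : C(OnePoint E, OnePoint E)) *
      (onePointGaussian E).comp ((affineHomeo b s hs).onePointCongr : C(OnePoint E, OnePoint E)) =
      c • (onePointGaussian E).comp
        ((affineHomeo m t ht).onePointCongr : C(OnePoint E, OnePoint E)) := by
  have hpos : 0 < r ^ 2 + s ^ 2 := by positivity
  refine ⟨Real.exp (-(r ^ 2 * s ^ 2 / (r ^ 2 + s ^ 2) * ‖a - b‖ ^ 2)),
    (r ^ 2 + s ^ 2)⁻¹ • (r ^ 2 • a + s ^ 2 • b), Real.sqrt (r ^ 2 + s ^ 2),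
    (Real.sqrt_pos.2 hpos).ne', ?_⟩
  ext z
  induction z using OnePoint.rec with
  | infty =>
    change (0 : ℝ) * 0 = _ * 0
    simp
  | coe z =>
    change Real.exp (-‖r • (z - a)‖ ^ 2) * Real.exp (-‖s • (z - b)‖ ^ 2) =
      Real.exp _ * Real.exp (-‖Real.sqrt (r ^ 2 + s ^ 2) • (z - _)‖ ^ 2)
    rw [← Real.exp_add, ← Real.exp_add]
    congr 1
    simp only [norm_smul, mul_pow, Real.norm_eq_abs, sq_abs, Real.sq_sqrt hpos.le,
      norm_sub_sq_real, norm_add_sq_real, inner_smul_left, inner_smul_right, inner_add_right,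
      abs_inv, inv_pow]
    simp only [conj_trivial]
    field_simp
    ring

/-- A closed subspace of functions on the one-point compactification of a Euclidean space that is
invariant under the homeomorphisms fixing infinity and contains `1` and a non-constant function
contains all functions. -/
theorem onePoint_invariant_eq_top (W : Submodule ℝ C(OnePoint E, ℝ))
    (hW : IsClosed (W : Set C(OnePoint E, ℝ))) (h1 : (1 : C(OnePoint E, ℝ)) ∈ W)
    (hinv : ∀ e : E ≃ₜ E, ∀ k ∈ W,
      k.comp (e.onePointCongr : C(OnePoint E, OnePoint E)) ∈ W)
    (hf : ∃ f ∈ W, ¬ ∃ c : ℝ, ∀ y, f y = c) : W = ⊤ := by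
  obtain ⟨f, hf, hne⟩ := hf
  obtain ⟨a, ha⟩ : ∃ a : E, f a ≠ f OnePoint.infty := by
    by_contra! h
    refine hne ⟨f OnePoint.infty, fun y => ?_⟩
    induction y using OnePoint.rec with
    | infty => rfl
    | coe z => exact h z
  have ha' : f a - f OnePoint.infty ≠ 0 := sub_ne_zero.2 ha
  have hg : onePointGaussian E ∈ W := by
    -- A translation moves `a` to the origin, and an affine change of values gives 1 there and 0 at
    -- infinity.
    refine onePointGaussian_mem W hW hinv ((f a - f OnePoint.infty)⁻¹ •
      (f.comp ((affineHomeo (-a) 1 one_ne_zero).onePointCongr : C(OnePoint E, OnePoint E)) -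
        f OnePoint.infty • 1))
      (W.smul_mem _ (W.sub_mem (hinv _ _ hf) (W.smul_mem _ h1))) ?_ ?_
    · change (f a - f OnePoint.infty)⁻¹ * (f ((1 : ℝ) • ((0 : E) - -a) : E) -
        f OnePoint.infty * 1) = 1
      simp [ha']
    · change (f a - f OnePoint.infty)⁻¹ * (f OnePoint.infty - f OnePoint.infty * 1) = 0
      simp
  have hset : gaussianSet E ⊆ W := by
    rintro k (hk | ⟨c, a, r, hr, rfl⟩)
    · rw [Set.mem_singleton_iff.1 hk]; exact h1
    · exact W.smul_mem _ (hinv _ _ hg)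
  -- Closure under products makes the linear span of the Gaussians and 1 an algebra lying in `W`.
  let M : Submonoid C(OnePoint E, ℝ) :=
    { carrier := gaussianSet E
      one_mem' := Or.inl rfl
      mul_mem' := by
        rintro k l (hk | ⟨c, a, r, hr, rfl⟩) hl
        · rw [Set.mem_singleton_iff.1 hk, one_mul]; exact hl
        · rcases hl with hl | ⟨d, b, s, hs, rfl⟩
          · rw [Set.mem_singleton_iff.1 hl, mul_one]
            exact Or.inr ⟨c, a, r, hr, rfl⟩
          · obtain ⟨c', m, t, ht, h⟩ := gaussian_mul a b r s hr hs
            refine Or.inr ⟨c * d * c', m, t, ht, ?_⟩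
            rw [smul_mul_smul_comm, h, smul_smul] }
  let A : Subalgebra ℝ C(OnePoint E, ℝ) := Algebra.adjoin ℝ (M : Set C(OnePoint E, ℝ))
  have hAW : (A : Set C(OnePoint E, ℝ)) ⊆ W := by
    intro k hk
    have : k ∈ Subalgebra.toSubmodule A := hk
    rw [Algebra.adjoin_eq_span, Submonoid.closure_eq] at this
    exact Submodule.span_le.2 hset this
  have hsep : A.SeparatesPoints := by
    have hmem : ∀ a : E, (onePointGaussian E).comp ((affineHomeo a 1 one_ne_zero).onePointCongr :
        C(OnePoint E, OnePoint E)) ∈ A := fun a =>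
      Algebra.subset_adjoin (Or.inr ⟨1, a, 1, one_ne_zero, (one_smul _ _).symm⟩)
    have hcase : ∀ (a : E) (y : OnePoint E), (a : OnePoint E) ≠ y →
        ∃ k ∈ A, k (a : OnePoint E) ≠ k y := by
      intro a y hay
      refine ⟨_, hmem a, ?_⟩
      have hl : (onePointGaussian E).comp ((affineHomeo a 1 one_ne_zero).onePointCongr :
          C(OnePoint E, OnePoint E)) (a : OnePoint E) = 1 := by
        change Real.exp (-‖(1 : ℝ) • (a - a)‖ ^ 2) = 1
        simp
      rw [hl]
      induction y using OnePoint.rec with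
      | infty => change (1 : ℝ) ≠ 0; exact one_ne_zero
      | coe b =>
        change (1 : ℝ) ≠ Real.exp (-‖(1 : ℝ) • (b - a)‖ ^ 2)
        rw [one_smul, ne_comm, Ne, Real.exp_eq_one_iff, neg_eq_zero, sq_eq_zero_iff, norm_eq_zero,
          sub_eq_zero]
        rintro rfl
        exact hay rfl
    intro x y hxy
    induction x using OnePoint.rec with
    | coe a =>
      obtain ⟨k, hk, h⟩ := hcase a y hxy
      exact ⟨k, ⟨k, hk, rfl⟩, h⟩
    | infty =>
      induction y using OnePoint.rec with
      | infty => exact absurd rfl hxy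
      | coe b =>
        obtain ⟨k, hk, h⟩ := hcase b OnePoint.infty hxy.symm
        exact ⟨k, ⟨k, hk, rfl⟩, h.symm⟩
  have htop := ContinuousMap.subalgebra_topologicalClosure_eq_top_of_separatesPoints A hsep
  rw [eq_top_iff]
  intro k _
  have hk : k ∈ A.topologicalClosure := by rw [htop]; trivial
  exact closure_minimal hAW hW hk

/-- A system that is the one-point compactification of a Euclidean space, with enough
homeomorphisms fixing infinity, has the linear Stone–Weierstrass property. -/
theorem hasLSW_of_onePoint {G : Type*} [Group G] {X : Type*} [TopologicalSpace X] [CompactSpace X]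
    (ψ : G →* (X ≃ₜ X)) (Φ : OnePoint E ≃ₜ X)
    (hψ : ∀ e : E ≃ₜ E, ∃ g, ψ g = (Φ.symm.trans e.onePointCongr).trans Φ) : HasLSW ψ := by
  refine hasLSW_of_closed_invariant ψ Φ fun W hW h1 hinv hf =>
    onePoint_invariant_eq_top W hW h1 (fun e k hk => ?_) hf
  obtain ⟨g, hg⟩ := hψ e
  refine Set.mem_of_eq_of_mem ?_ (hinv g k hk)
  ext x
  simp [hg]

end Radial

/-! ### The sphere and the stabilizer of the north pole -/

theorem norm_northPole : ‖(northPole : EuclideanSpace ℝ (Fin 3))‖ = 1 := by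
  simp [northPole]

/-- The equatorial plane of the sphere. -/
abbrev EquatorPlane : Type := (Submodule.span ℝ {(northPole : EuclideanSpace ℝ (Fin 3))})ᗮ

/-- The inverse of the stereographic projection from the north pole. -/
noncomputable def sphereHomeo : OnePoint EquatorPlane ≃ₜ Sphere2 :=
  onePointHyperplaneHomeoUnitSphere norm_northPole

theorem sphereHomeo_infty : sphereHomeo OnePoint.infty = northPole :=
  OnePoint.equivOfIsEmbeddingOfRangeEq_apply_infty _ _
    (isOpenEmbedding_stereographic_symm norm_northPole).toIsEmbedding
    (range_stereographic_symm norm_northPole)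

theorem sphereHomeo_symm_northPole : sphereHomeo.symm northPole = OnePoint.infty := by
  rw [Homeomorph.symm_apply_eq, sphereHomeo_infty]

/-- The homeomorphism of the sphere induced by a homeomorphism of the plane. -/
noncomputable def sphereExtend (e : EquatorPlane ≃ₜ EquatorPlane) : Sphere2 ≃ₜ Sphere2 :=
  (sphereHomeo.symm.trans e.onePointCongr).trans sphereHomeo

theorem sphereExtend_mem (e : EquatorPlane ≃ₜ EquatorPlane) :
    sphereExtend e ∈ pointStabilizer northPole := by
  change sphereHomeo (e.onePointCongr (sphereHomeo.symm northPole)) = northPole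
  rw [sphereHomeo_symm_northPole]
  exact sphereHomeo_infty

theorem sphereExtend_apply (e : EquatorPlane ≃ₜ EquatorPlane) (z : EquatorPlane) :
    sphereExtend e (sphereHomeo z) = sphereHomeo (e z) := by
  change sphereHomeo (e.onePointCongr (sphereHomeo.symm (sphereHomeo z))) = _
  rw [Homeomorph.symm_apply_apply]
  rfl

theorem nontrivial_equatorPlane : Nontrivial EquatorPlane := by
  have h : (northPole : EuclideanSpace ℝ (Fin 3)) ≠ 0 := by
    intro h
    have := norm_northPole
    rw [h, norm_zero] at this
    exact zero_ne_one this
  have : Fact (Module.finrank ℝ (EuclideanSpace ℝ (Fin 3)) = 2 + 1) := ⟨by simp⟩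
  have h2 : Module.finrank ℝ EquatorPlane = 2 := Submodule.finrank_orthogonal_span_singleton h
  exact Module.nontrivial_of_finrank_pos (R := ℝ) (by omega)

theorem hasLSW_homeoAction_sphere : HasLSW (homeoAction Sphere2) :=
  hasLSW_of_onePoint _ sphereHomeo fun e => ⟨sphereExtend e, rfl⟩

theorem hasLSW_pointStabilizer_northPole : HasLSW (pointStabilizer northPole).subtype :=
  hasLSW_of_onePoint _ sphereHomeo fun e => ⟨⟨sphereExtend e, sphereExtend_mem e⟩, rfl⟩

/-- Almost everywhere convergence of `g n` to a constant gives convergence of the push-forwards to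
a Dirac measure. -/
theorem tendsto_pushProba_dirac {X : Type*} [TopologicalSpace X] [MeasurableSpace X] [BorelSpace X]
    (μ : ProbabilityMeasure X) (g : ℕ → (X ≃ₜ X)) (x : X)
    (h : ∀ᵐ y ∂(μ : Measure X), Tendsto (fun n => g n y) atTop (𝓝 x)) :
    Tendsto (fun n => pushProba (g n) μ) atTop (𝓝 (diracProba x)) := by
  rw [ProbabilityMeasure.tendsto_iff_forall_integral_tendsto]
  intro f
  have h1 : ∀ n, ∫ y, f y ∂(pushProba (g n) μ : Measure X) = ∫ y, f (g n y) ∂(μ : Measure X) := by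
    intro n
    rw [pushProba, ProbabilityMeasure.toMeasure_map, integral_map]
    · exact (g n).continuous.measurable.aemeasurable
    · exact f.continuous.measurable.aestronglyMeasurable
  have h2 : ∫ y, f y ∂(diracProba x : Measure X) = ∫ _, f x ∂(μ : Measure X) := by
    simp only [diracProba, ProbabilityMeasure.coe_mk, integral_const, probReal_univ,
      one_smul]
    exact integral_dirac' _ _ f.continuous.measurable.stronglyMeasurable
  simp only [h1, h2]
  refine tendsto_integral_of_dominated_convergence (fun _ => ‖f‖) ?_ (integrable_const _) ?_ ?_
  · intro n
    exact (f.continuous.comp (g n).continuous).measurable.aestronglyMeasurable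
  · intro n
    exact ae_of_all _ fun y => f.norm_coe_le_norm _
  · filter_upwards [h] with y hy
    exact (f.continuous.tendsto x).comp hy

/-- A probability measure has countably many atoms, so some point `a` of the plane has measure zero.
Dilations about `a` with factor n + 1 push every other point to infinity. -/
theorem isStronglyProximal_pointStabilizer_northPole :
    IsStronglyProximal (pointStabilizer northPole).subtype := by
  intro μ
  have : Nontrivial EquatorPlane := nontrivial_equatorPlane
  obtain ⟨a, ha⟩ : ∃ a : EquatorPlane, (μ : Measure Sphere2) {sphereHomeo a} = 0 := by
    by_contra! h
    have hc := Measure.countable_meas_level_set_pos (μ := (μ : Measure Sphere2)) measurable_id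
    have hu : (Set.univ : Set EquatorPlane).Countable := by
      refine Set.Countable.mono (fun a _ => ?_) (hc.preimage_of_injOn
        (f := fun a : EquatorPlane => sphereHomeo a)
        (fun a _ b _ hab => OnePoint.coe_injective (sphereHomeo.injective hab)))
      exact pos_iff_ne_zero.2 (h a)
    have hcard := (Cardinal.le_aleph0_iff_set_countable.2 hu)
    have := continuum_le_cardinal_of_module ℝ EquatorPlane
    rw [Cardinal.mk_univ] at hcard
    exact absurd (this.trans hcard) (not_le.2 Cardinal.aleph0_lt_continuum)
  have hn : ∀ n : ℕ, ((n : ℝ) + 1) ≠ 0 := fun n => by positivity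
  refine ⟨fun n => ⟨sphereExtend (affineHomeo a _ (hn n)), sphereExtend_mem _⟩, northPole,
    tendsto_pushProba_dirac μ _ _ ?_⟩
  have hae : ∀ᵐ y ∂(μ : Measure Sphere2), y ≠ sphereHomeo a := by
    rw [ae_iff]; simpa using ha
  filter_upwards [hae] with y hy
  obtain ⟨y, rfl⟩ := sphereHomeo.surjective y
  induction y using OnePoint.rec with
  | infty =>
    rw [sphereHomeo_infty]
    exact tendsto_const_nhds.congr fun n => (sphereExtend_mem (affineHomeo a _ (hn n))).symm
  | coe z =>
    have hz : z - a ≠ 0 := sub_ne_zero.2 fun h => hy (by rw [h])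
    have h1 : ∀ n, (pointStabilizer northPole).subtype
        ⟨sphereExtend (affineHomeo a _ (hn n)), sphereExtend_mem _⟩ (sphereHomeo z) =
        sphereHomeo (((n : ℝ) + 1) • (z - a) : EquatorPlane) := fun n =>
      sphereExtend_apply (affineHomeo a _ (hn n)) z
    simp only [h1]
    suffices hp : ∀ p, sphereHomeo OnePoint.infty = p → Tendsto (fun n : ℕ =>
        sphereHomeo (((n : ℝ) + 1) • (z - a) : EquatorPlane)) atTop (𝓝 p) from
      hp _ sphereHomeo_infty
    rintro _ rfl
    refine (sphereHomeo.continuous.tendsto _).comp ?_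
    have h2 : Tendsto (fun n : ℕ => ((n : ℝ) + 1) • (z - a)) atTop (coclosedCompact EquatorPlane) := by
      rw [coclosedCompact_eq_cocompact, ← Metric.cobounded_eq_cocompact,
        ← tendsto_norm_atTop_iff_cobounded]
      have h3 : Tendsto (fun n : ℕ => ((n : ℝ) + 1) * ‖z - a‖) atTop atTop :=
        (tendsto_atTop_add_const_right _ _ tendsto_natCast_atTop_atTop).atTop_mul_const
          (norm_pos_iff.2 hz)
      refine h3.congr fun n => ?_
      rw [norm_smul, Real.norm_of_nonneg (by positivity)]
    exact OnePoint.tendsto_coe_infty.comp h2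

theorem pointStabilizer_northPole_fixed_iff (x : Sphere2) :
    (∀ h ∈ pointStabilizer northPole, h x = x) ↔ x = northPole := by
  constructor
  · intro h
    obtain ⟨y, rfl⟩ := sphereHomeo.surjective x
    induction y using OnePoint.rec with
    | infty => exact sphereHomeo_infty
    | coe z =>
      have : Nontrivial EquatorPlane := nontrivial_equatorPlane
      obtain ⟨v, hv⟩ := exists_ne (0 : EquatorPlane)
      have h1 := h _ (sphereExtend_mem (Homeomorph.addRight v))
      rw [sphereExtend_apply] at h1
      have h2 := OnePoint.coe_injective (sphereHomeo.injective h1)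
      exact absurd (by simpa using h2) hv
  · rintro rfl h hh
    exact hh

/-! ### The translation on Z ∪ {∞}: primality and strong proximality -/

theorem onePointShift_zpow_coe (n m : ℤ) :
    (onePointShift ^ n) (m : OnePoint ℤ) = ((m + n : ℤ) : OnePoint ℤ) := by
  induction n using Int.induction_on generalizing m with
  | zero => simp
  | succ i ih =>
    rw [zpow_add_one, Homeomorph.mul_apply]
    change (onePointShift ^ (i : ℤ)) ((m + 1 : ℤ) : OnePoint ℤ) = _
    rw [ih]; congr 1; ring
  | pred i ih =>
    rw [zpow_sub_one, Homeomorph.mul_apply]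
    change (onePointShift ^ (-i : ℤ)) ((m + -1 : ℤ) : OnePoint ℤ) = _
    rw [ih]; congr 1; ring

theorem onePointShift_zpow_infty (n : ℤ) :
    (onePointShift ^ n) OnePoint.infty = OnePoint.infty := by
  induction n using Int.induction_on with
  | zero => simp
  | succ i ih =>
    rw [zpow_add_one, Homeomorph.mul_apply]
    exact ih
  | pred i ih =>
    rw [zpow_sub_one, Homeomorph.mul_apply]
    exact ih

theorem cascade_onePointShift_coe (n m : ℤ) :
    cascade onePointShift (Multiplicative.ofAdd n) (m : OnePoint ℤ) =
      ((m + n : ℤ) : OnePoint ℤ) := by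
  rw [cascade, zpowersHom_apply, toAdd_ofAdd, onePointShift_zpow_coe]

theorem cascade_onePointShift_infty (n : ℤ) :
    cascade onePointShift (Multiplicative.ofAdd n) OnePoint.infty = OnePoint.infty := by
  rw [cascade, zpowersHom_apply, toAdd_ofAdd, onePointShift_zpow_infty]

theorem tendsto_onePoint_of_injective {s : ℕ → ℤ} (hs : Function.Injective s) :
    Tendsto (fun n => ((s n : ℤ) : OnePoint ℤ)) atTop (𝓝 OnePoint.infty) := by
  refine OnePoint.tendsto_coe_infty.comp ?_
  rw [coclosedCompact_eq_cocompact, cocompact_eq_cofinite, ← Nat.cofinite_eq_atTop]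
  exact hs.tendsto_cofinite

/-- The translation of the one-point compactification of the integers is prime. -/
theorem isPrimeSystem_onePointShift.{u} : IsPrimeSystem.{u} (cascade onePointShift) := by
  intro Y _ _ _ φ π hπ hY
  obtain ⟨u, v, huv⟩ := exists_pair_ne Y
  have hfalse : (∀ m : ℤ, π m = π OnePoint.infty) → False := by
    intro h
    have hall : ∀ x, π x = π OnePoint.infty := by
      intro x
      induction x using OnePoint.rec with
      | infty => rfl
      | coe m => exact h m
    obtain ⟨x, rfl⟩ := hπ.surjective u
    obtain ⟨y, rfl⟩ := hπ.surjective v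
    exact huv ((hall x).trans (hall y).symm)
  -- Infinity is fixed, so an integer identified with it drags its whole orbit along.
  have hinf : ∀ m : ℤ, π m ≠ π OnePoint.infty := by
    intro m hm
    refine hfalse fun k => ?_
    have h1 := hπ.equivariant (Multiplicative.ofAdd (k - m)) m
    have h2 := hπ.equivariant (Multiplicative.ofAdd (k - m)) OnePoint.infty
    rw [cascade_onePointShift_coe, add_sub_cancel] at h1
    rw [cascade_onePointShift_infty] at h2
    rw [h1, hm, ← h2]
  have hcoe : ∀ a b : ℤ, π a = π b → a = b := by
    intro a b hab
    by_contra hne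
    have hd : b - a ≠ 0 := sub_ne_zero.2 (Ne.symm hne)
    have hstep : ∀ k : ℤ, π k = π ((k + (b - a) : ℤ) : OnePoint ℤ) := by
      intro k
      have h1 := hπ.equivariant (Multiplicative.ofAdd (k - a)) a
      have h2 := hπ.equivariant (Multiplicative.ofAdd (k - a)) b
      rw [cascade_onePointShift_coe, add_sub_cancel] at h1
      rw [cascade_onePointShift_coe] at h2
      rw [h1, hab, ← h2]
      congr 2; ring
    refine hfalse fun k => ?_
    have hmul : ∀ j : ℕ, π ((k + j * (b - a) : ℤ) : OnePoint ℤ) = π k := by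
      intro j
      induction j with
      | zero => simp
      | succ j ih =>
        rw [← ih, hstep (k + j * (b - a))]
        congr 2; push_cast; ring
    -- Along the progression with step `b - a` the image is constant while the points tend to
    -- infinity, so `π k = π ∞`.
    have ht : Tendsto (fun j : ℕ => π ((k + j * (b - a) : ℤ) : OnePoint ℤ)) atTop
        (𝓝 (π OnePoint.infty)) := by
      refine (hπ.continuous.tendsto _).comp (tendsto_onePoint_of_injective ?_)
      intro i j hij
      have h3 : (i : ℤ) * (b - a) = j * (b - a) := add_left_cancel hij
      exact_mod_cast mul_right_cancel₀ hd h3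
    simp only [hmul] at ht
    exact tendsto_nhds_unique tendsto_const_nhds ht
  intro x y hxy
  induction x using OnePoint.rec with
  | infty =>
    induction y using OnePoint.rec with
    | infty => rfl
    | coe b => exact absurd hxy.symm (hinf b)
  | coe a =>
    induction y using OnePoint.rec with
    | infty => exact absurd hxy (hinf a)
    | coe b => rw [hcoe a b hxy]

theorem isStronglyProximal_onePointShift : IsStronglyProximal (cascade onePointShift) := by
  intro μ
  refine ⟨fun n => Multiplicative.ofAdd (n : ℤ), OnePoint.infty,
    tendsto_pushProba_dirac μ _ _ (ae_of_all _ fun y => ?_)⟩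
  induction y using OnePoint.rec with
  | infty => simp only [cascade_onePointShift_infty]; exact tendsto_const_nhds
  | coe m =>
    simp only [cascade_onePointShift_coe]
    refine tendsto_onePoint_of_injective fun i j hij => ?_
    exact_mod_cast add_left_cancel hij

/-! ### Failure of LSW: Fourier coefficients of a tent function -/

section Tent

/-- The Fourier coefficients of a multiple of the tent function of the circle `ℝ / ℤ` supported in
`[-1/4, 1/4]`. -/
noncomputable def tentCoeff (n : ℤ) : ℝ :=
  -- At n = 0 the first summand is 0 because 1 / 0 = 0; π²/8 is the limit of (1 - cos(πn/2))/n² at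
  -- 0.
  (1 - Real.cos (Real.pi * n / 2)) * (1 / (n : ℝ) ^ 2) + if n = 0 then Real.pi ^ 2 / 8 else 0

theorem tentCoeff_zero : tentCoeff 0 = Real.pi ^ 2 / 8 := by simp [tentCoeff]

theorem tentCoeff_neg (n : ℤ) : tentCoeff (-n) = tentCoeff n := by
  have : Real.pi * ((-n : ℤ) : ℝ) / 2 = -(Real.pi * n / 2) := by push_cast; ring
  rw [tentCoeff, tentCoeff, this, Real.cos_neg]
  simp

theorem summable_tentCoeff : Summable tentCoeff := by
  refine Summable.add ?_ ?_
  · refine Summable.of_norm_bounded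
      ((Real.summable_one_div_int_pow (p := 2)).2 one_lt_two |>.mul_left 2) fun n => ?_
    rw [norm_mul, Real.norm_of_nonneg (show (0 : ℝ) ≤ 1 / (n : ℝ) ^ 2 by positivity),
      Real.norm_eq_abs]
    gcongr
    rw [abs_le]
    constructor <;> linarith [Real.neg_one_le_cos (Real.pi * n / 2),
      Real.cos_le_one (Real.pi * n / 2)]
  · exact (hasSum_ite_eq (0 : ℤ) (Real.pi ^ 2 / 8)).summable

/-- The Fourier series of the second Bernoulli polynomial x² - x + 1/6. -/
theorem hasSum_cos_div_sq {x : ℝ} (hx : x ∈ Set.Icc (0 : ℝ) 1) :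
    HasSum (fun n : ℕ => 1 / (n : ℝ) ^ 2 * Real.cos (2 * Real.pi * n * x))
      (Real.pi ^ 2 * (x ^ 2 - x + 1 / 6)) := by
  have h := hasSum_one_div_nat_pow_mul_cos one_ne_zero hx
  convert! h using 1
  simp [Polynomial.bernoulli, Finset.sum_range_succ, Polynomial.eval_monomial]
  ring

/-- The sum of the Fourier series with coefficients `tentCoeff` vanishes away from `0`. -/
theorem tent_eq_zero {x : ℝ} (hx : x ∈ Set.Icc (1 / 4 : ℝ) (3 / 4)) {S : ℂ}
    (hS : HasSum (fun n : ℤ => (tentCoeff n : ℂ) * fourier n (x : AddCircle (1 : ℝ))) S) :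
    S = 0 := by
  have h1 := hS.nat_add_neg
  have hcos : ∀ n : ℕ, (tentCoeff n : ℂ) * fourier (n : ℤ) (x : AddCircle (1 : ℝ)) +
      (tentCoeff (-(n : ℤ)) : ℂ) * fourier (-(n : ℤ)) (x : AddCircle (1 : ℝ)) =
      ((tentCoeff n * (2 * Real.cos (2 * Real.pi * n * x)) : ℝ) : ℂ) := by
    intro n
    rw [tentCoeff_neg, fourier_coe_apply, fourier_coe_apply]
    push_cast
    rw [← mul_add, Complex.two_cos]
    congr 3 <;> ring_nf
  simp only [hcos] at h1
  -- The cosine series is a second difference with step 1/4 of the Bernoulli series. As x ± 1/4 stay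
  -- in [0, 1], it is the second difference of a single quadratic, hence the constant -π²/8.
  have h2 := (((hasSum_cos_div_sq (x := x) ⟨by linarith [hx.1], by linarith [hx.2]⟩).mul_left 2).sub
    (hasSum_cos_div_sq (x := x + 1 / 4) ⟨by linarith [hx.1], by linarith [hx.2]⟩)).sub
    (hasSum_cos_div_sq (x := x - 1 / 4) ⟨by linarith [hx.1], by linarith [hx.2]⟩)
  -- Folding ℤ onto ℕ counts the term n = 0 twice. The total π²/8 is therefore `S + tentCoeff 0`,
  -- which forces `S = 0`.
  have h3 := h2.add (hasSum_ite_eq (0 : ℕ) (2 * (Real.pi ^ 2 / 8)))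
  have h4 : HasSum (fun n : ℕ => tentCoeff n * (2 * Real.cos (2 * Real.pi * n * x)))
      (Real.pi ^ 2 / 8) := by
    convert! h3 using 1
    · funext n
      have e1 : 2 * Real.pi * n * (x + 1 / 4) = 2 * Real.pi * n * x + Real.pi * n / 2 := by ring
      have e2 : 2 * Real.pi * n * (x - 1 / 4) = 2 * Real.pi * n * x - Real.pi * n / 2 := by ring
      rw [e1, e2, Real.cos_add, Real.cos_sub, tentCoeff]
      rcases eq_or_ne n 0 with rfl | hn
      · simp; ring
      · rw [if_neg (by exact_mod_cast hn), if_neg hn]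
        push_cast; ring
    · ring
  have h5 := h1.unique (Complex.hasSum_ofReal.2 h4)
  rw [tentCoeff_zero] at h5
  simpa using h5

/-- The `k`-th Fourier coefficient as a continuous linear functional on continuous functions. -/
noncomputable def fourierCoeffCLM (k : ℤ) : C(AddCircle (1 : ℝ), ℂ) →L[ℂ] ℂ :=
  LinearMap.mkContinuous
    { toFun := fun F => fourierCoeff F k
      map_add' := fun F G => by
        simp only [fourierCoeff, ContinuousMap.add_apply, smul_add]
        have hi : ∀ H : C(AddCircle (1 : ℝ), ℂ), Integrable (fun t => fourier (-k) t • H t)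
            (AddCircle.haarAddCircle (T := (1 : ℝ))) := fun H =>
          (by fun_prop : Continuous fun t => fourier (-k) t • H t).integrable_of_hasCompactSupport
            (HasCompactSupport.of_compactSpace _)
        exact integral_add (hi F) (hi G)
      map_smul' := fun c F => by
        simp only [fourierCoeff, ContinuousMap.smul_apply, smul_eq_mul, RingHom.id_apply]
        rw [← integral_const_mul]
        congr 1; funext t; ring } 1 (by
    intro F
    rw [one_mul]
    refine (norm_integral_le_of_norm_le_const (C := ‖F‖) (ae_of_all _ fun t => ?_)).trans ?_
    · rw [norm_smul, fourier_apply, Circle.norm_coe, one_mul]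
      exact F.norm_coe_le_norm t
    · simp)

theorem fourierCoeffCLM_apply (k : ℤ) (F : C(AddCircle (1 : ℝ), ℂ)) :
    fourierCoeffCLM k F = fourierCoeff F k := rfl

theorem fourierCoeffCLM_fourier (k n : ℤ) :
    fourierCoeffCLM k (fourier n) = if k = n then 1 else 0 := by
  rw [fourierCoeffCLM_apply, fourierCoeff_fourier, Pi.single_apply]

/-- The convolution of `(-1) ^ n * tentCoeff n` with `tentCoeff` is zero. -/
theorem hasSum_tentCoeff_mul (k : ℤ) :
    HasSum (fun n : ℤ => (-1) ^ n * tentCoeff n * tentCoeff (n + k)) 0 := by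
  have hone : ∀ n : ℤ, ‖((-1 : ℂ) ^ n)‖ = 1 := fun n => by simp
  have hs : Summable fun n : ℤ => (tentCoeff n : ℂ) • (fourier n : C(AddCircle (1 : ℝ), ℂ)) := by
    refine Summable.of_norm_bounded summable_tentCoeff.norm fun n => ?_
    rw [norm_smul, fourier_norm, mul_one, Complex.norm_real]
  have hs' : Summable fun n : ℤ =>
      ((-1) ^ n * tentCoeff n : ℂ) • (fourier n : C(AddCircle (1 : ℝ), ℂ)) := by
    refine Summable.of_norm_bounded summable_tentCoeff.norm fun n => ?_
    rw [norm_smul, fourier_norm, mul_one, norm_mul, hone, one_mul, Complex.norm_real]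
  obtain ⟨F, hF⟩ := hs
  obtain ⟨G, hG⟩ := hs'
  have hF0 : ∀ x : ℝ, x ∈ Set.Icc (1 / 4 : ℝ) (3 / 4) → F (x : AddCircle (1 : ℝ)) = 0 := fun x hx =>
    tent_eq_zero hx ((ContinuousMap.evalCLM ℂ (x : AddCircle (1 : ℝ))).hasSum hF)
  have hG0 : ∀ x : ℝ, x + 1 / 2 ∈ Set.Icc (1 / 4 : ℝ) (3 / 4) → G (x : AddCircle (1 : ℝ)) = 0 := by
    intro x hx
    refine tent_eq_zero hx ?_
    convert! (ContinuousMap.evalCLM ℂ (x : AddCircle (1 : ℝ))).hasSum hG using 1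
    funext n
    change _ = ((-1) ^ n * tentCoeff n : ℂ) * fourier n (x : AddCircle (1 : ℝ))
    have hshift : fourier n ((x + 1 / 2 : ℝ) : AddCircle (1 : ℝ)) =
        (-1 : ℂ) ^ n * fourier n (x : AddCircle (1 : ℝ)) := by
      rw [fourier_coe_apply, fourier_coe_apply, ← Complex.exp_pi_mul_I, ← Complex.exp_int_mul,
        ← Complex.exp_add]
      congr 1
      push_cast
      ring
    rw [hshift]
    ring
  -- `G` is `F` translated by 1/2; the zero sets [1/4, 3/4] and [-1/4, 1/4] together cover the
  -- circle.
  have hFG : F * G = 0 := by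
    ext y
    obtain ⟨x, rfl⟩ := QuotientAddGroup.mk_surjective y
    change F (x : AddCircle (1 : ℝ)) * G (x : AddCircle (1 : ℝ)) = 0
    have hx : ((x - ⌊x + 1 / 4⌋ : ℝ) : AddCircle (1 : ℝ)) = (x : AddCircle (1 : ℝ)) := by
      rw [AddCircle.coe_sub, sub_eq_self, AddCircle.coe_eq_zero_iff]
      exact ⟨⌊x + 1 / 4⌋, by simp⟩
    rw [← hx]
    have h1 := Int.floor_le (x + 1 / 4)
    have h2 := Int.lt_floor_add_one (x + 1 / 4)
    rcases le_total (1 / 4) (x - ⌊x + 1 / 4⌋) with h | h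
    · rw [hF0 _ ⟨h, by linarith⟩, zero_mul]
    · rw [hG0 _ ⟨by linarith, by linarith⟩, mul_zero]
  have hcoef : ∀ j n : ℤ, fourierCoeffCLM j (F * fourier n) = tentCoeff (j - n) := by
    intro j n
    have h1 := (fourierCoeffCLM j).hasSum (hF.mul_right (fourier n : C(AddCircle (1 : ℝ), ℂ)))
    refine h1.unique ?_
    have h2 : ∀ m : ℤ, fourierCoeffCLM j (((tentCoeff m : ℂ) • fourier m) *
        (fourier n : C(AddCircle (1 : ℝ), ℂ))) =
        if m = j - n then (tentCoeff (j - n) : ℂ) else 0 := by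
      intro m
      have : (fourier m : C(AddCircle (1 : ℝ), ℂ)) * fourier n = fourier (m + n) := by
        ext t; simp
      rw [smul_mul_assoc, this, map_smul, fourierCoeffCLM_fourier]
      by_cases hm : m = j - n
      · rw [if_pos hm, if_pos (by omega), hm]; simp
      · rw [if_neg hm, if_neg (by omega)]; simp
    simp only [h2]
    exact hasSum_ite_eq _ _
  -- The coefficient of `F * G` at -k is the sum of G_n F_(-k-n); evenness of `tentCoeff` turns -k -
  -- n into n + k.
  have h1 := (fourierCoeffCLM (-k)).hasSum (hG.mul_left F)
  rw [hFG, map_zero] at h1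
  rw [← Complex.hasSum_ofReal, Complex.ofReal_zero]
  convert! h1 using 1
  funext n
  rw [mul_smul_comm, map_smul, hcoef, ← tentCoeff_neg (n + k), smul_eq_mul]
  push_cast
  congr 3; ring

/-- This is the value of the tent at 1/2, where the characters equal (-1)^n. -/
theorem hasSum_alternating_tentCoeff : HasSum (fun n : ℤ => (-1) ^ n * tentCoeff n) 0 := by
  have hs : Summable fun n : ℤ => ((-1) ^ n * tentCoeff n : ℂ) := by
    refine Summable.of_norm_bounded summable_tentCoeff.norm fun n => ?_
    simp
  obtain ⟨S, hS⟩ := hs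
  have : S = 0 := by
    refine tent_eq_zero (x := 1 / 2) ⟨by norm_num, by norm_num⟩ ?_
    convert! hS using 1
    funext n
    rw [fourier_coe_apply, mul_comm, ← Complex.exp_pi_mul_I, ← Complex.exp_int_mul]
    congr 2
    push_cast
    ring
  rw [this] at hS
  rw [← Complex.hasSum_ofReal]
  simpa using hS

theorem not_hasLSW_onePointShift : ¬ HasLSW (cascade onePointShift) := by
  intro h
  have ht : Tendsto tentCoeff (coclosedCompact ℤ) (𝓝 0) := by
    rw [coclosedCompact_eq_cocompact, cocompact_eq_cofinite]
    exact summable_tentCoeff.tendsto_cofinite_zero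
  let f : C(OnePoint ℤ, ℝ) :=
    OnePoint.continuousMapMk ⟨tentCoeff, continuous_of_discreteTopology⟩ 0 ht
  have hf : ¬ ∃ c : ℝ, ∀ x, f x = c := by
    rintro ⟨c, hc⟩
    have h1 : tentCoeff 0 = c := hc ((0 : ℤ) : OnePoint ℤ)
    have h2 : (0 : ℝ) = c := hc OnePoint.infty
    rw [tentCoeff_zero, ← h2] at h1
    exact absurd h1 (by positivity)
  have hd := h f hf
  have hb : ∀ (k : C(OnePoint ℤ, ℝ)) (n : ℤ),
      ‖(-1) ^ n * tentCoeff n * k (n : OnePoint ℤ)‖ ≤ ‖tentCoeff n‖ * ‖k‖ := by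
    intro k n
    rw [norm_mul, norm_mul, norm_zpow, norm_neg, norm_one, one_zpow, one_mul]
    gcongr
    exact k.norm_coe_le_norm _
  have hsum : ∀ k : C(OnePoint ℤ, ℝ),
      Summable fun n : ℤ => (-1) ^ n * tentCoeff n * k (n : OnePoint ℤ) := fun k =>
    Summable.of_norm_bounded (summable_tentCoeff.norm.mul_right _) (hb k)
  -- Integration against the signed measure with mass (-1)^n `tentCoeff n` at n. It kills 1 and all
  -- translates of `f`, but not the indicator of 0.
  let Λ : C(OnePoint ℤ, ℝ) →L[ℝ] ℝ := LinearMap.mkContinuous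
    { toFun := fun k => ∑' n : ℤ, (-1) ^ n * tentCoeff n * k (n : OnePoint ℤ)
      map_add' := fun k l => by
        rw [← (hsum k).tsum_add (hsum l)]
        simp only [ContinuousMap.add_apply, mul_add]
      map_smul' := fun c k => by
        simp only [ContinuousMap.smul_apply, smul_eq_mul, RingHom.id_apply]
        rw [← tsum_mul_left]
        congr 1; funext n; ring } (∑' n, ‖tentCoeff n‖) (fun k => by
      rw [← tsum_mul_right]
      exact tsum_of_norm_bounded (summable_tentCoeff.norm.mul_right _).hasSum (hb k))
  have hΛ : ∀ k, Λ k = ∑' n : ℤ, (-1) ^ n * tentCoeff n * k (n : OnePoint ℤ) := fun _ => rfl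
  have hle : Submodule.span ℝ (Set.range (fun g : Multiplicative ℤ =>
      f.comp (cascade onePointShift g : C(OnePoint ℤ, OnePoint ℤ))) ∪ {(1 : C(OnePoint ℤ, ℝ))}) ≤
      LinearMap.ker (Λ : C(OnePoint ℤ, ℝ) →ₗ[ℝ] ℝ) := by
    rw [Submodule.span_le]
    rintro k (⟨g, rfl⟩ | hk)
    · change Λ _ = 0
      rw [hΛ, ← (hasSum_tentCoeff_mul (Multiplicative.toAdd g)).tsum_eq]
      congr 1; funext n
      have := cascade_onePointShift_coe (Multiplicative.toAdd g) n
      rw [ofAdd_toAdd] at this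
      rw [ContinuousMap.comp_apply, ContinuousMap.coe_coe, this]
      rfl
    · rw [Set.mem_singleton_iff.1 hk]
      change Λ _ = 0
      rw [hΛ, ← hasSum_alternating_tentCoeff.tsum_eq]
      simp
  have hall := Submodule.topologicalClosure_minimal _ hle Λ.isClosed_ker
  rw [hd] at hall
  have ht1 : Tendsto (fun n : ℤ => if n = 0 then (1 : ℝ) else 0) (coclosedCompact ℤ) (𝓝 0) := by
    rw [coclosedCompact_eq_cocompact, cocompact_eq_cofinite]
    exact (hasSum_ite_eq (0 : ℤ) (1 : ℝ)).summable.tendsto_cofinite_zero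
  let d : C(OnePoint ℤ, ℝ) :=
    OnePoint.continuousMapMk ⟨fun n : ℤ => if n = 0 then (1 : ℝ) else 0,
      continuous_of_discreteTopology⟩ 0 ht1
  have hd0 : Λ d = 0 := hall (x := d) trivial
  rw [hΛ, tsum_eq_single 0] at hd0
  · have h1 : d ((0 : ℤ) : OnePoint ℤ) = 1 := rfl
    rw [h1, tentCoeff_zero] at hd0
    simp at hd0
  · intro n hn
    have h1 : d (n : OnePoint ℤ) = if n = 0 then (1 : ℝ) else 0 := rfl
    rw [h1, if_neg hn, mul_zero]

end Tent

/-! ### Clopen sets and homeomorphisms of the Cantor set -/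

section Cantor

/-- A bijection between discrete spaces as a homeomorphism. -/
def discreteHomeo {K L : Type*} [TopologicalSpace K] [DiscreteTopology K] [TopologicalSpace L]
    [DiscreteTopology L] (e : K ≃ L) : K ≃ₜ L where
  toEquiv := e
  continuous_toFun := continuous_of_discreteTopology
  continuous_invFun := continuous_of_discreteTopology

/-- Splitting off the first `m` coordinates of the Cantor space. -/
def cantorSplit (m : ℕ) : (ℕ → Bool) ≃ₜ (Fin m → Bool) × (ℕ → Bool) :=
  (Homeomorph.piCongrLeft (Y := fun _ => Bool) (finSumNatEquiv m)).symm.trans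
    Homeomorph.sumArrowHomeomorphProdArrow

theorem nonempty_sum_cantor_homeo : Nonempty ((ℕ → Bool) ⊕ (ℕ → Bool) ≃ₜ (ℕ → Bool)) := by
  have e : Unit ⊕ Unit ≃ (Fin 1 → Bool) :=
    (Equiv.boolEquivPUnitSumPUnit.symm).trans (Equiv.funUnique (Fin 1) Bool).symm
  exact ⟨((Homeomorph.sumCongr (Homeomorph.punitProd (ℕ → Bool)).symm
    (Homeomorph.punitProd (ℕ → Bool)).symm).trans Homeomorph.sumProdDistrib.symm).trans
    (((discreteHomeo e).prodCongr (Homeomorph.refl _)).trans (cantorSplit 1).symm)⟩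

theorem nonempty_fin_prod_cantor_homeo (n : ℕ) :
    Nonempty (Fin (n + 1) × (ℕ → Bool) ≃ₜ (ℕ → Bool)) := by
  induction n with
  | zero => exact ⟨((discreteHomeo (finOneEquiv)).prodCongr (Homeomorph.refl _)).trans
      (Homeomorph.punitProd (ℕ → Bool))⟩
  | succ n ih =>
    obtain ⟨e⟩ := ih
    obtain ⟨s⟩ := nonempty_sum_cantor_homeo
    have d : Fin (n + 1 + 1) ≃ Fin (n + 1) ⊕ Unit :=
      (finSuccEquiv (n + 1)).trans (Equiv.optionEquivSumPUnit _)
    exact ⟨((((discreteHomeo d).prodCongr (Homeomorph.refl _)).trans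
      Homeomorph.sumProdDistrib).trans
      (Homeomorph.sumCongr e (Homeomorph.punitProd (ℕ → Bool)))).trans s⟩

/-- Membership in a clopen subset of the Cantor space depends on finitely many coordinates. -/
theorem IsClopen.exists_coordinates {A : Set (ℕ → Bool)} (hA : IsClopen A) :
    ∃ m : ℕ, ∀ x y : ℕ → Bool, (∀ i < m, x i = y i) → x ∈ A → y ∈ A := by
  have h : ∀ x ∈ A, ∃ n, PiNat.cylinder x n ⊆ A := by
    intro x hx
    obtain ⟨s, ⟨y, n, rfl⟩, hxs, hs⟩ :=
      (PiNat.isTopologicalBasis_cylinders (fun _ : ℕ => Bool)).exists_subset_of_mem_open hx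
        hA.isOpen
    exact ⟨n, (PiNat.mem_cylinder_iff_eq.1 hxs).le.trans hs⟩
  choose! n hn using h
  obtain ⟨t, ht, hcov⟩ := hA.isClosed.isCompact.elim_nhds_subcover (fun x => PiNat.cylinder x (n x))
    fun x _ => (PiNat.isOpen_cylinder _ x (n x)).mem_nhds (PiNat.self_mem_cylinder x (n x))
  refine ⟨t.sup n, fun x y hxy hx => ?_⟩
  obtain ⟨z, hz, hxz⟩ := Set.mem_iUnion₂.1 (hcov hx)
  refine hn z (ht z hz) fun i hi => ?_
  rw [← hxy i (hi.trans_le (Finset.le_sup hz))]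
  exact hxz i hi

/-- A non-empty clopen subset of the Cantor space is homeomorphic to the Cantor space. -/
theorem IsClopen.nonempty_homeo_cantor {A : Set (ℕ → Bool)} (hA : IsClopen A) (hne : A.Nonempty) :
    Nonempty (A ≃ₜ (ℕ → Bool)) := by
  obtain ⟨m, hm⟩ := hA.exists_coordinates
  -- `A` depends on the first `m` coordinates only, so it is a finite set times the Cantor space.
  let S : Set (Fin m → Bool) := {w | ∃ x ∈ A, (cantorSplit m x).1 = w}
  have hS : ∀ x, x ∈ A ↔ (cantorSplit m x).1 ∈ S := by
    refine fun x => ⟨fun hx => ⟨x, hx, rfl⟩, ?_⟩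
    rintro ⟨y, hy, hyx⟩
    exact hm y x (fun i hi => congrFun hyx ⟨i, hi⟩) hy
  obtain ⟨x₀, hx₀⟩ := hne
  have hSne : Nonempty S := ⟨⟨_, (hS x₀).1 hx₀⟩⟩
  let e₁ : A ≃ₜ {q : (Fin m → Bool) × (ℕ → Bool) // q.1 ∈ S} := (cantorSplit m).subtype hS
  let e₂ : {q : (Fin m → Bool) × (ℕ → Bool) // q.1 ∈ S} ≃ₜ S × (ℕ → Bool) :=
    { toFun := fun q => (⟨q.1.1, q.2⟩, q.1.2)
      invFun := fun q => ⟨(q.1, q.2), q.1.2⟩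
      left_inv := fun _ => rfl
      right_inv := fun _ => rfl
      continuous_toFun := by fun_prop
      continuous_invFun := by fun_prop }
  obtain ⟨n, ⟨d⟩⟩ := Finite.exists_equiv_fin S
  obtain _ | n := n
  · exact (d hSne.some).elim0
  obtain ⟨e₃⟩ := nonempty_fin_prod_cantor_homeo n
  exact ⟨((e₁.trans e₂).trans ((discreteHomeo d).prodCongr (Homeomorph.refl _))).trans e₃⟩

theorem continuous_glue {X Z K : Type*} [TopologicalSpace X] [TopologicalSpace Z]
    [TopologicalSpace K] [DiscreteTopology K] {p : X → K} (hp : Continuous p)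
    (h : ∀ k, {x // p x = k} → Z) (hc : ∀ k, Continuous (h k)) :
    Continuous fun x => h (p x) ⟨x, rfl⟩ := by
  have hon : ∀ k, ContinuousOn (fun x => h (p x) ⟨x, rfl⟩) {x | p x = k} := by
    intro k
    rw [continuousOn_iff_continuous_domRestrict]
    refine (hc k).congr ?_
    rintro ⟨x, rfl⟩
    rfl
  rw [continuous_iff_continuousAt]
  intro x
  exact (hon (p x)).continuousAt (((isOpen_discrete {p x}).preimage hp).mem_nhds rfl)

/-- Homeomorphisms between the pieces of two clopen partitions can be glued. -/
theorem exists_homeo_glue {X K : Type*} [TopologicalSpace X] [TopologicalSpace K]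
    [DiscreteTopology K] {p q : X → K} (hp : Continuous p) (hq : Continuous q)
    (h : ∀ k, {x // p x = k} ≃ₜ {x // q x = k}) :
    ∃ e : X ≃ₜ X, ∀ k x (hx : p x = k), e x = h k ⟨x, hx⟩ := by
  refine ⟨{ toFun := fun x => h (p x) ⟨x, rfl⟩
            invFun := fun y => (h (q y)).symm ⟨y, rfl⟩
            left_inv := ?_
            right_inv := ?_
            continuous_toFun := continuous_glue hp (fun k x => (h k x : X))
              fun k => continuous_subtype_val.comp (h k).continuous
            continuous_invFun := continuous_glue hq (fun k x => ((h k).symm x : X))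
              fun k => continuous_subtype_val.comp (h k).symm.continuous }, ?_⟩
  · intro x
    have : ∀ k y (hy : q y = k), ((h (q y)).symm ⟨y, rfl⟩ : X) = (h k).symm ⟨y, hy⟩ := by
      rintro k y rfl; rfl
    change ((h (q (h (p x) ⟨x, rfl⟩))).symm ⟨h (p x) ⟨x, rfl⟩, rfl⟩ : X) = x
    rw [this (p x) _ (h (p x) ⟨x, rfl⟩).2]
    simp
  · intro y
    have : ∀ k x (hx : p x = k), ((h (p x)) ⟨x, rfl⟩ : X) = h k ⟨x, hx⟩ := by
      rintro k y rfl; rfl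
    change (h (p ((h (q y)).symm ⟨y, rfl⟩)) ⟨(h (q y)).symm ⟨y, rfl⟩, rfl⟩ : X) = y
    rw [this (q y) _ ((h (q y)).symm ⟨y, rfl⟩).2]
    simp
  · rintro k x rfl
    rfl

/-- Both fibres are non-empty clopen sets, hence Cantor sets. With gluing, any two finite clopen
partitions into non-empty pieces can be matched. -/
theorem nonempty_homeo_fiber {K : Type*} [TopologicalSpace K] [DiscreteTopology K]
    {p q : (ℕ → Bool) → K} (hp : Continuous p) (hq : Continuous q) {k l : K}
    (hpk : ∃ x, p x = k) (hql : ∃ x, q x = l) : Nonempty ({x // p x = k} ≃ₜ {x // q x = l}) := by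
  obtain ⟨a⟩ := ((isClopen_discrete {k}).preimage hp).nonempty_homeo_cantor hpk
  obtain ⟨b⟩ := ((isClopen_discrete {l}).preimage hq).nonempty_homeo_cantor hql
  exact ⟨a.trans b.symm⟩

/-- The labelling of a space by the sets `A`, `B` and the rest. -/
noncomputable def tripleLabel {X : Type*} (A B : Set X) (x : X) : Fin 3 := by
  classical exact if x ∈ A then 0 else if x ∈ B then 1 else 2

theorem tripleLabel_of_mem_left {X : Type*} {A B : Set X} {x : X} (hx : x ∈ A) :
    tripleLabel A B x = 0 := by simp [tripleLabel, hx]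

theorem tripleLabel_of_mem_right {X : Type*} {A B : Set X} (h : Disjoint A B) {x : X}
    (hx : x ∈ B) : tripleLabel A B x = 1 := by
  simp [tripleLabel, hx, h.notMem_of_mem_right hx]

theorem tripleLabel_of_notMem {X : Type*} {A B : Set X} {x : X} (hx : x ∉ A) (hx' : x ∉ B) :
    tripleLabel A B x = 2 := by simp [tripleLabel, hx, hx']

theorem mem_of_tripleLabel_eq_zero {X : Type*} {A B : Set X} {x : X} (h : tripleLabel A B x = 0) :
    x ∈ A := by
  simp only [tripleLabel] at h
  split_ifs at h with h1 h2
  · exact h1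
  · simp at h
  · simp at h

theorem mem_of_tripleLabel_eq_one {X : Type*} {A B : Set X} {x : X} (h : tripleLabel A B x = 1) :
    x ∈ B := by
  simp only [tripleLabel] at h
  split_ifs at h with h1 h2
  · simp at h
  · exact h2
  · simp at h

theorem continuous_tripleLabel {X : Type*} [TopologicalSpace X] {A B : Set X} (hA : IsClopen A)
    (hB : IsClopen B) : Continuous (tripleLabel A B) := by
  classical
  have h : Continuous fun x => if x ∈ A then (0 : Fin 3) else if x ∈ B then 1 else 2 := by
    refine continuous_const.if (fun a ha => ?_) (continuous_const.if (fun a ha => ?_)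
      continuous_const)
    · change a ∈ frontier A at ha
      rw [hA.frontier_eq] at ha
      exact ha.elim
    · change a ∈ frontier B at ha
      rw [hB.frontier_eq] at ha
      exact ha.elim
  refine h.congr fun x => ?_
  simp only [tripleLabel]

/-- The indicator function of a clopen set. -/
noncomputable def clopenIndicator {X : Type*} [TopologicalSpace X] {A : Set X} (hA : IsClopen A) :
    C(X, ℝ) :=
  (LocallyConstant.charFn ℝ hA).toContinuousMap

theorem clopenIndicator_of_mem {X : Type*} [TopologicalSpace X] {A : Set X} (hA : IsClopen A)
    {x : X} (hx : x ∈ A) : clopenIndicator hA x = 1 := Set.indicator_of_mem hx _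

theorem clopenIndicator_of_notMem {X : Type*} [TopologicalSpace X] {A : Set X} (hA : IsClopen A)
    {x : X} (hx : x ∉ A) : clopenIndicator hA x = 0 := Set.indicator_of_notMem hx _

variable (W : Submodule ℝ C(ℕ → Bool, ℝ)) (hW : IsClosed (W : Set C(ℕ → Bool, ℝ)))
  (hinv : ∀ e : (ℕ → Bool) ≃ₜ (ℕ → Bool), ∀ k ∈ W, k.comp (e : C(ℕ → Bool, ℕ → Bool)) ∈ W)
  (hf : ∃ f ∈ W, ¬ ∃ c : ℝ, ∀ y, f y = c)

include hW hinv hf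

/-- Let `f x ≠ f y`. A homeomorphism `e` carries `A` close to `x` and `B` close to `y`, and an
involution-like `σ` exchanges `A` with `B` and fixes the rest. In f∘e - f∘e∘σ the rest cancels
exactly, leaving approximately (f x - f y)(1_A - 1_B). -/
theorem clopenIndicator_sub_mem {A B : Set (ℕ → Bool)} (hA : IsClopen A) (hB : IsClopen B)
    (hAne : A.Nonempty) (hBne : B.Nonempty) (hAB : Disjoint A B) (hcompl : ∃ x, x ∉ A ∧ x ∉ B) :
    clopenIndicator hA - clopenIndicator hB ∈ W := by
  obtain ⟨f, hfW, hne⟩ := hf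
  obtain ⟨x, y, hxy⟩ : ∃ x y, f x ≠ f y := by
    by_contra! h
    exact hne ⟨f fun _ => false, fun y => h y _⟩
  have hxy' : x ≠ y := fun h => hxy (by rw [h])
  have hc : f x - f y ≠ 0 := sub_ne_zero.2 hxy
  -- A third point, kept outside the neighbourhoods of `x` and `y`, so that the piece receiving the
  -- complement of `A` and `B` is non-empty.
  obtain ⟨z, hz⟩ := (Set.toFinite ({x, y} : Set (ℕ → Bool))).exists_notMem
  simp only [Set.mem_insert_iff, Set.mem_singleton_iff, not_or] at hz
  obtain ⟨hzx, hzy⟩ := hz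
  obtain ⟨a, ha⟩ := hAne
  obtain ⟨b, hb⟩ := hBne
  obtain ⟨c, hcA, hcB⟩ := hcompl
  set p := tripleLabel A B with hp
  have hpc : Continuous p := continuous_tripleLabel hA hB
  have pa : p a = 0 := tripleLabel_of_mem_left ha
  have pb : p b = 1 := tripleLabel_of_mem_right hAB hb
  have pc : p c = 2 := tripleLabel_of_notMem hcA hcB
  set p' := fun x => Equiv.swap (0 : Fin 3) 1 (p x) with hp'
  have hpc' : Continuous p' := continuous_of_discreteTopology.comp hpc
  have hsig : ∀ k, ∃ h : {x // p x = k} ≃ₜ {x // p' x = k}, k = 2 → ∀ x, (h x : ℕ → Bool) = x := by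
    intro k
    by_cases hk : k = 2
    · subst hk
      have : {x | p x = 2} = {x | p' x = 2} := by
        ext x
        simp only [hp', Set.mem_ofPred_eq]
        generalize p x = j
        revert j; decide
      exact ⟨Homeomorph.setCongr this, fun _ _ => rfl⟩
    · obtain ⟨h⟩ := nonempty_homeo_fiber (k := k) (l := k) hpc hpc'
        (by fin_cases k; exacts [⟨a, pa⟩, ⟨b, pb⟩, ⟨c, pc⟩])
        (by
          fin_cases k
          · exact ⟨b, by simp [hp', pb]⟩
          · exact ⟨a, by simp [hp', pa]⟩
          · exact absurd rfl hk)
      exact ⟨h, fun h => absurd h hk⟩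
  choose hs hs2 using hsig
  obtain ⟨σ, hσ⟩ := exists_homeo_glue hpc hpc' hs
  have hσp : ∀ x, p' (σ x) = p x := by
    intro x
    rw [hσ (p x) x rfl]
    exact (hs (p x) ⟨x, rfl⟩).2
  have hσ2 : ∀ x, p x = 2 → σ x = x := by
    intro x hx
    rw [hσ 2 x hx, hs2 2 rfl]
  have key : ∀ ε > 0, ∃ k ∈ W,
      ‖k - (f x - f y) • (clopenIndicator hA - clopenIndicator hB)‖ ≤ 2 * ε := by
    intro ε hε
    have hnhds : ∀ u v : ℕ → Bool, u ≠ v → z ≠ u → ∃ U : Set (ℕ → Bool), IsClopen U ∧ u ∈ U ∧ z ∉ U ∧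
        v ∉ U ∧ ∀ w ∈ U, |f w - f u| ≤ ε := by
      intro u v huv hzu
      have hopen : IsOpen ({w | |f w - f u| < ε} ∩ ({z}ᶜ ∩ {v}ᶜ)) :=
        (isOpen_lt (by fun_prop) continuous_const).inter
          (isOpen_compl_singleton.inter isOpen_compl_singleton)
      obtain ⟨U, hU, huU, hsub⟩ := isTopologicalBasis_isClopen.exists_subset_of_mem_open
        (show u ∈ {w | |f w - f u| < ε} ∩ ({z}ᶜ ∩ {v}ᶜ) from
          ⟨by simpa using hε, hzu.symm, huv⟩) hopen
      exact ⟨U, hU, huU, fun h => (hsub h).2.1 rfl, fun h => (hsub h).2.2 rfl,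
        fun w hw => (hsub hw).1.le⟩
    obtain ⟨U, hU, hxU, hzU, hyU, hUε⟩ := hnhds x y hxy' hzx
    obtain ⟨V, hV, hyV, hzV, -, hVε⟩ := hnhds y x hxy'.symm hzy
    -- Removing `U` makes the pieces disjoint; `y` survives because `y ∉ U`.
    have hV' : IsClopen (V \ U) := hV.diff hU
    have hdisj : Disjoint U (V \ U) := Set.disjoint_sdiff_right
    have hqc : Continuous (tripleLabel U (V \ U)) := continuous_tripleLabel hU hV'
    have hfib : ∀ k, Nonempty ({x // p x = k} ≃ₜ {x // tripleLabel U (V \ U) x = k}) := by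
      intro k
      refine nonempty_homeo_fiber hpc hqc ?_ ?_
      · fin_cases k; exacts [⟨a, pa⟩, ⟨b, pb⟩, ⟨c, pc⟩]
      · fin_cases k
        exacts [⟨x, tripleLabel_of_mem_left hxU⟩, ⟨y, tripleLabel_of_mem_right hdisj ⟨hyV, hyU⟩⟩,
          ⟨z, tripleLabel_of_notMem hzU fun h => hzV h.1⟩]
    obtain ⟨e, he⟩ := exists_homeo_glue hpc hqc fun k => (hfib k).some
    have heq : ∀ x, tripleLabel U (V \ U) (e x) = p x := by
      intro x
      rw [he (p x) x rfl]
      exact ((hfib (p x)).some ⟨x, rfl⟩).2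
    have he0 : ∀ w, p w = 0 → |f (e w) - f x| ≤ ε := fun w hw =>
      hUε _ (mem_of_tripleLabel_eq_zero ((heq w).trans hw))
    have he1 : ∀ w, p w = 1 → |f (e w) - f y| ≤ ε := fun w hw =>
      hVε _ (mem_of_tripleLabel_eq_one ((heq w).trans hw)).1
    refine ⟨f.comp (e : C(ℕ → Bool, ℕ → Bool)) -
      (f.comp (e : C(ℕ → Bool, ℕ → Bool))).comp (σ : C(ℕ → Bool, ℕ → Bool)),
      W.sub_mem (hinv _ _ hfW) (hinv _ _ (hinv _ _ hfW)), ?_⟩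
    rw [ContinuousMap.norm_le _ (by positivity)]
    intro w
    change |f (e w) - f (e (σ w)) - (f x - f y) * (clopenIndicator hA w - clopenIndicator hB w)| ≤ _
    have hsw := hσp w
    by_cases hwA : w ∈ A
    · have hw0 : p w = 0 := tripleLabel_of_mem_left hwA
      have hw1 : p (σ w) = 1 := by
        rw [hw0] at hsw
        exact (Equiv.swap (0 : Fin 3) 1).injective (hsw.trans (by simp))
      rw [clopenIndicator_of_mem hA hwA,
        clopenIndicator_of_notMem hB (hAB.notMem_of_mem_left hwA)]
      have h1 := abs_le.1 (he0 w hw0)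
      have h2 := abs_le.1 (he1 _ hw1)
      rw [abs_le]
      constructor <;> linarith [h1.1, h1.2, h2.1, h2.2]
    · by_cases hwB : w ∈ B
      · have hw0 : p w = 1 := tripleLabel_of_mem_right hAB hwB
        have hw1 : p (σ w) = 0 := by
          rw [hw0] at hsw
          exact (Equiv.swap (0 : Fin 3) 1).injective (hsw.trans (by simp))
        rw [clopenIndicator_of_mem hB hwB, clopenIndicator_of_notMem hA hwA]
        have h1 := abs_le.1 (he1 w hw0)
        have h2 := abs_le.1 (he0 _ hw1)
        rw [abs_le]
        constructor <;> linarith [h1.1, h1.2, h2.1, h2.2]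
      · rw [hσ2 w (tripleLabel_of_notMem hwA hwB), clopenIndicator_of_notMem hA hwA,
          clopenIndicator_of_notMem hB hwB]
        simp only [sub_self, mul_zero, abs_zero]
        positivity
  have hmem : (f x - f y) • (clopenIndicator hA - clopenIndicator hB) ∈ W := by
    rw [← SetLike.mem_coe, ← hW.closure_eq, Metric.mem_closure_iff]
    intro ε hε
    obtain ⟨k, hk, hkε⟩ := key (ε / 4) (by positivity)
    refine ⟨k, hk, ?_⟩
    rw [dist_comm, dist_eq_norm]
    linarith
  have := W.smul_mem (f x - f y)⁻¹ hmem
  rwa [smul_smul, inv_mul_cancel₀ hc, one_smul] at this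

omit hW hinv hf in
theorem IsClopen.exists_split {D : Set (ℕ → Bool)} (hD : IsClopen D) (hne : D.Nonempty) :
    ∃ D₁ D₂ : Set (ℕ → Bool), IsClopen D₁ ∧ IsClopen D₂ ∧ D₁.Nonempty ∧ D₂.Nonempty ∧
      Disjoint D₁ D₂ ∧ D₁ ⊆ D ∧ D₂ ⊆ D := by
  obtain ⟨e⟩ := hD.nonempty_homeo_cantor hne
  obtain ⟨u, v, huv⟩ := exists_pair_ne (ℕ → Bool)
  have hxy : (e.symm u : ℕ → Bool) ≠ e.symm v := fun h =>
    huv (e.symm.injective (Subtype.ext h))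
  obtain ⟨S, hS, hu, hv⟩ := exists_isClopen_of_totally_separated hxy
  exact ⟨D ∩ S, D ∩ Sᶜ, hD.inter hS, hD.inter hS.compl, ⟨_, (e.symm u).2, hu⟩,
    ⟨_, (e.symm v).2, hv⟩, Set.disjoint_left.2 fun x hx hx' => hx'.2 hx.2,
    Set.inter_subset_left, Set.inter_subset_left⟩

theorem clopenIndicator_mem (h1 : (1 : C(ℕ → Bool, ℝ)) ∈ W) {B : Set (ℕ → Bool)}
    (hB : IsClopen B) : clopenIndicator hB ∈ W := by
  rcases B.eq_empty_or_nonempty with rfl | hBne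
  · have : clopenIndicator hB = 0 := by
      ext x; exact clopenIndicator_of_notMem hB (Set.notMem_empty x)
    rw [this]; exact W.zero_mem
  rcases Bᶜ.eq_empty_or_nonempty with hBc | hBc
  · have : clopenIndicator hB = 1 := by
      ext x
      exact clopenIndicator_of_mem hB (by rw [Set.compl_empty_iff.1 hBc]; trivial)
    rw [this]; exact h1
  -- For disjoint A₁, A₂ outside `B`, 1_B = (1_(A₁∪A₂) - 1_B) - (1_(A₁) - 1_B) - (1_(A₂) - 1_B). The
  -- third piece A₃ provides the point `c` outside all the sets, which each difference requires.
  obtain ⟨A₁, D, hA₁, hD, hA₁ne, hDne, hA₁D, hA₁B, hDB⟩ := hB.compl.exists_split hBc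
  obtain ⟨A₂, A₃, hA₂, hA₃, hA₂ne, ⟨c, hc⟩, hA₂₃, hA₂D, hA₃D⟩ := hD.exists_split hDne
  have d₁ : Disjoint A₁ B := Set.disjoint_left.2 fun x hx hx' => hA₁B hx hx'
  have d₂ : Disjoint A₂ B := Set.disjoint_left.2 fun x hx hx' => hDB (hA₂D hx) hx'
  have d₁₂ : Disjoint A₁ A₂ := hA₁D.mono_right hA₂D
  have c₁ : c ∉ A₁ := fun h => Set.disjoint_left.1 hA₁D h (hA₃D hc)
  have c₂ : c ∉ A₂ := fun h => Set.disjoint_left.1 hA₂₃ h hc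
  have cB : c ∉ B := hDB (hA₃D hc)
  have m₁ := clopenIndicator_sub_mem W hW hinv hf hA₁ hB hA₁ne hBne d₁ ⟨c, c₁, cB⟩
  have m₂ := clopenIndicator_sub_mem W hW hinv hf hA₂ hB hA₂ne hBne d₂ ⟨c, c₂, cB⟩
  have m₃ := clopenIndicator_sub_mem W hW hinv hf (hA₁.union hA₂) hB (hA₁ne.inl) hBne
    (d₁.sup_left d₂) ⟨c, fun h => h.elim c₁ c₂, cB⟩
  have : clopenIndicator hB = (clopenIndicator (hA₁.union hA₂) - clopenIndicator hB) -
      (clopenIndicator hA₁ - clopenIndicator hB) - (clopenIndicator hA₂ - clopenIndicator hB) := by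
    have hadd : clopenIndicator (hA₁.union hA₂) = clopenIndicator hA₁ + clopenIndicator hA₂ := by
      ext x
      rw [ContinuousMap.add_apply]
      by_cases x₁ : x ∈ A₁
      · rw [clopenIndicator_of_mem (hA₁.union hA₂) (Or.inl x₁), clopenIndicator_of_mem _ x₁,
          clopenIndicator_of_notMem _ (d₁₂.notMem_of_mem_left x₁), add_zero]
      · by_cases x₂ : x ∈ A₂
        · rw [clopenIndicator_of_mem (hA₁.union hA₂) (Or.inr x₂), clopenIndicator_of_mem _ x₂,
            clopenIndicator_of_notMem _ x₁, zero_add]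
        · rw [clopenIndicator_of_notMem (hA₁.union hA₂) (fun h => h.elim x₁ x₂),
            clopenIndicator_of_notMem _ x₁,
            clopenIndicator_of_notMem _ x₂, add_zero]
    rw [hadd]
    abel
  rw [this]
  exact W.sub_mem (W.sub_mem m₃ m₁) m₂

/-- A closed subspace of functions on the Cantor space that is invariant under homeomorphisms and
contains `1` and a non-constant function contains all functions. -/
theorem cantor_invariant_eq_top (h1 : (1 : C(ℕ → Bool, ℝ)) ∈ W) : W = ⊤ := by
  let M : Submonoid C(ℕ → Bool, ℝ) :=
    { carrier := {k | ∃ (A : Set (ℕ → Bool)) (hA : IsClopen A), k = clopenIndicator hA}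
      one_mem' := ⟨Set.univ, isClopen_univ, by
        ext x; exact (clopenIndicator_of_mem isClopen_univ (Set.mem_univ x)).symm⟩
      mul_mem' := by
        rintro _ _ ⟨A, hA, rfl⟩ ⟨B, hB, rfl⟩
        refine ⟨A ∩ B, hA.inter hB, ?_⟩
        ext x
        rw [ContinuousMap.mul_apply]
        by_cases hxA : x ∈ A
        · rw [clopenIndicator_of_mem hA hxA, one_mul]
          by_cases hxB : x ∈ B
          · rw [clopenIndicator_of_mem hB hxB, clopenIndicator_of_mem (hA.inter hB) ⟨hxA, hxB⟩]
          · rw [clopenIndicator_of_notMem hB hxB,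
              clopenIndicator_of_notMem (hA.inter hB) fun h => hxB h.2]
        · rw [clopenIndicator_of_notMem hA hxA, zero_mul,
            clopenIndicator_of_notMem (hA.inter hB) fun h => hxA h.1] }
  let A : Subalgebra ℝ C(ℕ → Bool, ℝ) := Algebra.adjoin ℝ (M : Set C(ℕ → Bool, ℝ))
  have hAW : (A : Set C(ℕ → Bool, ℝ)) ⊆ W := by
    intro k hk
    have : k ∈ Subalgebra.toSubmodule A := hk
    rw [Algebra.adjoin_eq_span, Submonoid.closure_eq] at this
    refine Submodule.span_le.2 ?_ this
    rintro _ ⟨B, hB, rfl⟩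
    exact clopenIndicator_mem W hW hinv hf h1 hB
  have hsep : A.SeparatesPoints := by
    intro x y hxy
    obtain ⟨S, hS, hx, hy⟩ := exists_isClopen_of_totally_separated hxy
    refine ⟨_, ⟨clopenIndicator hS, Algebra.subset_adjoin ⟨S, hS, rfl⟩, rfl⟩, ?_⟩
    change clopenIndicator hS x ≠ clopenIndicator hS y
    rw [clopenIndicator_of_mem hS hx, clopenIndicator_of_notMem hS hy]
    exact one_ne_zero
  have htop := ContinuousMap.subalgebra_topologicalClosure_eq_top_of_separatesPoints A hsep
  rw [eq_top_iff]
  intro k _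
  have hk : k ∈ A.topologicalClosure := by rw [htop]; trivial
  exact closure_minimal hAW hW hk

end Cantor

/-! ### Transfer to the ternary Cantor set and conclusion -/

theorem compactSpace_cantorSet : CompactSpace cantorSet :=
  cantorSetHomeomorphNatToBool.symm.compactSpace

theorem hasLSW_homeoAction_cantorSet : HasLSW (homeoAction cantorSet) := by
  have := compactSpace_cantorSet
  refine hasLSW_of_closed_invariant _ cantorSetHomeomorphNatToBool.symm
    fun W hW h1 hinv hf => cantor_invariant_eq_top W hW (fun e k hk => ?_) hf h1
  convert! hinv ((cantorSetHomeomorphNatToBool.trans e).trans cantorSetHomeomorphNatToBool.symm) k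
    hk using 1
  ext x
  simp [homeoAction]

theorem mainTheorem8 :
    -- the rotation of the integers modulo a prime
    (∀ p : ℕ, p.Prime →
      IsPrimeSystem.{z} (cascade (zmodShift p)) ∧
      (IsAffinelyPrime.{z} (cascade (zmodShift p)) ↔ p = 2 ∨ p = 3)) ∧
    -- the Cantor set with its full homeomorphism group
    (HasLSW (homeoAction cantorSet) ∧ IsAffinelyPrime.{z} (homeoAction cantorSet)) ∧
    -- the sphere with its full homeomorphism group
    (HasLSW (homeoAction Sphere2) ∧ IsAffinelyPrime.{z} (homeoAction Sphere2)) ∧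
    -- the sphere with the group of homeomorphisms fixing the north pole
    (IsAffinelyPrime.{z} (pointStabilizer northPole).subtype ∧
      IsStronglyProximal (pointStabilizer northPole).subtype ∧
      (∀ x : Sphere2, (∀ h ∈ pointStabilizer northPole, h x = x) ↔ x = northPole)) ∧
    -- the translation of the one-point compactification of the integers
    (IsPrimeSystem.{z} (cascade onePointShift) ∧
      IsStronglyProximal (cascade onePointShift) ∧
      ¬ HasLSW (cascade onePointShift)) :=
  ⟨fun _ hp => ⟨isPrimeSystem_zmodShift hp, isAffinelyPrime_zmodShift_iff hp⟩,
    ⟨hasLSW_homeoAction_cantorSet,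
      have := compactSpace_cantorSet
      hasLSW_homeoAction_cantorSet.isAffinelyPrime⟩,
    ⟨hasLSW_homeoAction_sphere, hasLSW_homeoAction_sphere.isAffinelyPrime⟩,
    ⟨hasLSW_pointStabilizer_northPole.isAffinelyPrime,
      isStronglyProximal_pointStabilizer_northPole, pointStabilizer_northPole_fixed_iff⟩,
    isPrimeSystem_onePointShift, isStronglyProximal_onePointShift, not_hasLSW_onePointShift⟩
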